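/- Let $\Gamma$ be a countable infinite connected graph (loops are permitted) with symmetric edge weights $\mu_{x,y}=\mu_{y,x}\ge 0$, where $\mu_{x,y}>0$ exactly when $x\sim y$, and suppose that $\mu(x)=\sum_{y\sim x}\mu_{x,y}<\infty$ for every vertex $x$. For $A\subset\Gamma$ put $\mu(A)=\sum_{y\in A}\mu(y)$. Let $(X_n)$ be the random walk on $\Gamma$ with transition probabilities $P(x,y)=\mu_{x,y}/\mu(x)$, and let $P_n(x,y)=\mathbb P(X_n=y\mid X_0=x)$ and $p_n(x,y)=P_n(x,y)/\mu(y)$. Let $d$ be the shortest-path distance; for real $R$ let $B(x,R)=\{y: d(x,y)<R\}$ and $V(x,R)=\mu(B(x,R))$. Let $T_{B(x,R)}=\min\{k\ge 0: X_k\notin B(x,R)\}$ be the exit time of the ball, let $E(x,R)=\mathbb E(T_{B(x,R)}\mid X_0=x)$ be its mean (so $E(x,0)=0$), and for $n\in\mathbb N$ let $e(x,n)=\min\{R\in\mathbb N: E(x,R)\ge n\}$. Suppose that the following four conditions hold. - $(p_0)$: there is $p_0>0$ such that $\mu_{x,y}/\mu(x)\ge p_0$ for all $x\sim y$. - $(VD)$: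 there is $D_V>0$ such that $V(x,2R)\le D_V\,V(x,R)$ for all $x\in\Gamma$ and all real $R>0$. - $(TC)$: there is $C_T>1$ such that $E(x,2R)/E(y,R)\le C_T$ for all $x\in\Gamma$, all real $R>0$ and all $y\in B(x,R)$. - $(DUE)$: there is $C>0$ such that $p_n(x,x)\le C/V(x,e(x,n))$ for all $x\in\Gamma$ and all integers $n>0$. Then the following upper estimate holds. - $(UE)$: there are constants $C>1$, $\beta>1$ and $c>0$ such that for all $x,y\in\Gamma$ and all integers $n>0$ $$p_n(x,y)\le\frac{C}{V(x,e(x,n))}\exp\left[-c\left(\frac{E(x,d(x,y))}{n}\right)^{\frac{1}{\beta-1}}\right].$$ -/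

import Mathlib

open scoped ENNReal NNReal

/-- A connected weighted graph on the vertex set `Γ`: a symmetric weight, with `x ∼ y` if and only
if the weight of `(x, y)` is positive (loops are permitted, but play no role in connectedness and
distance), and with finite total weight at each vertex. -/
structure WeightedGraph (Γ : Type*) where
  /-- The weight `μ_{x,y}`. -/
  weight : Γ → Γ → ℝ≥0
  weight_symm : ∀ x y, weight x y = weight y x
  summable_weight : ∀ x, Summable (weight x)
  connected : (SimpleGraph.fromRel fun x y => 0 < weight x y).Connected

namespace WeightedGraph

variable {Γ : Type*} (G : WeightedGraph Γ)

/-- The underlying graph, without its loops. -/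
def graph : SimpleGraph Γ := SimpleGraph.fromRel fun x y => 0 < G.weight x y

/-- The measure `μ(x) = ∑_{y ∼ x} μ_{x,y}` of a vertex. -/
noncomputable def mass (x : Γ) : ℝ≥0 := ∑' y, G.weight x y

theorem mass_pos [Nontrivial Γ] (x : Γ) : 0 < G.mass x := by
  obtain ⟨y, hy⟩ := exists_ne x
  obtain ⟨p⟩ := G.connected.preconnected x y
  cases p with
  | nil => exact absurd rfl hy
  | @cons _ z _ h _ =>
    rw [SimpleGraph.fromRel_adj] at h
    refine lt_of_lt_of_le ?_ ((G.summable_weight x).le_tsum' z)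
    rcases h.2 with h | h
    · exact h
    · rw [G.weight_symm]
      exact h

/-- The one-step transition probability `P(x,y) = μ_{x,y} / μ(x)`. -/
noncomputable def prob (x y : Γ) : ℝ≥0 := G.weight x y / G.mass x

theorem hasSum_prob [Nontrivial Γ] (x : Γ) :
    HasSum (fun y => (G.prob x y : ℝ≥0∞)) 1 := by
  have h : HasSum (G.prob x) 1 := by
    have := (G.summable_weight x).hasSum.div_const (G.mass x)
    rwa [← mass, div_self (G.mass_pos x).ne'] at this
  rw [← ENNReal.coe_one]
  exact ENNReal.hasSum_coe.2 h

/-- The distribution of the next position of the walk when it is at `x`. -/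
noncomputable def stepPMF [Nontrivial Γ] (x : Γ) : PMF Γ :=
  ⟨fun y => (G.prob x y : ℝ≥0∞), G.hasSum_prob x⟩

/-- The open ball `B(x,R) = {y : d(x,y) < R}` of the graph distance. -/
def ball (x : Γ) (R : ℝ) : Set Γ := {y | (G.graph.dist x y : ℝ) < R}

/-- The volume `V(x,R) = μ(B(x,R))`. -/
noncomputable def V (x : Γ) (R : ℝ) : ℝ := (∑' y : G.ball x R, (G.mass y : ℝ≥0∞)).toReal

section Walk

variable [MeasurableSpace Γ] [DiscreteMeasurableSpace Γ] [Countable Γ] [Nontrivial Γ]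

/-- The transition kernels of the walk: given the trajectory up to time `n`, the position at time
`n + 1` has the distribution `P(x_n, ·)`. -/
noncomputable def stepKernel (n : ℕ) :
    ProbabilityTheory.Kernel ((_ : Finset.Iic n) → Γ) Γ where
  toFun h := (G.stepPMF (h ⟨n, Finset.mem_Iic.2 le_rfl⟩)).toMeasure
  measurable' := (Measurable.of_discrete (f := fun x => (G.stepPMF x).toMeasure)).comp
    (measurable_pi_apply _)

instance (n : ℕ) : ProbabilityTheory.IsMarkovKernel (G.stepKernel n) :=
  ⟨fun _ => by unfold stepKernel; exact PMF.toMeasure.isProbabilityMeasure _⟩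

/-- The law `ℙ_x` of the random walk `(X_n)` with `X_0 = x`, on the space of trajectories, where
`X_n` is the `n`-th coordinate. -/
noncomputable def law (x : Γ) : MeasureTheory.Measure (ℕ → Γ) :=
  ProbabilityTheory.Kernel.traj (X := fun _ => Γ) G.stepKernel 0 fun _ => x

instance (x : Γ) : MeasureTheory.IsProbabilityMeasure (G.law x) := by
  unfold law; infer_instance

/-- The finite-dimensional distributions of the random walk. -/
theorem law_cylinder (x : Γ) (a : ℕ → Γ) (ha : a 0 = x) (n : ℕ) :
    G.law x {ω | ∀ i ≤ n, ω i = a i}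
      = ∏ i ∈ Finset.range n, (G.prob (a i) (a (i + 1)) : ℝ≥0∞) := by
  induction n with
  | zero =>
    have h := ProbabilityTheory.Kernel.traj_map_frestrictLe_apply (X := fun _ => Γ)
      (κ := G.stepKernel) 0 0 (fun _ => x)
    rw [ProbabilityTheory.Kernel.partialTraj_self, ProbabilityTheory.Kernel.id_apply] at h
    have hm : MeasurableSet {f : (Finset.Iic 0) → Γ | f ⟨0, by simp⟩ = a 0} :=
      measurableSet_eq_fun (measurable_pi_apply _) measurable_const
    have h2 := congrArg (fun m => m {f : (Finset.Iic 0) → Γ | f ⟨0, by simp⟩ = a 0}) h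
    rw [MeasureTheory.Measure.map_apply (by fun_prop) hm,
      MeasureTheory.Measure.dirac_apply' _ hm] at h2
    simpa [law, Set.preimage, ha] using h2
  | succ n ih =>
    have h := ProbabilityTheory.Kernel.partialTraj_compProd_eq_map_traj (X := fun _ => Γ)
      (κ := G.stepKernel) (Nat.zero_le n) (x₀ := fun _ => x)
    have hS : MeasurableSet {f : (Finset.Iic n) → Γ | ∀ i, f i = a i} := by
      rw [Set.ofPred_forall]
      exact MeasurableSet.iInter fun i =>
        measurableSet_eq_fun (measurable_pi_apply _) measurable_const
    have h2 := congrArg (fun m => m ({f : (Finset.Iic n) → Γ | ∀ i, f i = a i} ×ˢ {a (n + 1)})) h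
    rw [MeasureTheory.Measure.map_apply (by fun_prop) (hS.prod (measurableSet_singleton _)),
      MeasureTheory.Measure.compProd_apply_prod hS (measurableSet_singleton _),
      MeasureTheory.setLIntegral_congr_fun (g := fun _ => (G.prob (a n) (a (n + 1)) : ℝ≥0∞)) hS,
      MeasureTheory.setLIntegral_const,
      ← ProbabilityTheory.Kernel.traj_map_frestrictLe_apply,
      MeasureTheory.Measure.map_apply (by fun_prop) hS] at h2
    · have e1 : {ω : ℕ → Γ | ∀ i ≤ n + 1, ω i = a i} =
          (fun ω : ℕ → Γ => (Preorder.frestrictLe (π := fun _ => Γ) n ω, ω (n + 1))) ⁻¹'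
            ({f : (Finset.Iic n) → Γ | ∀ i, f i = a i} ×ˢ {a (n + 1)}) := by
        ext ω
        simp [Nat.le_succ_iff_eq_or_le, or_imp, forall_and, and_comm]
      have e2 : {ω : ℕ → Γ | ∀ i ≤ n, ω i = a i} =
          Preorder.frestrictLe (π := fun _ => Γ) n ⁻¹'
            {f : (Finset.Iic n) → Γ | ∀ i, f i = a i} := by
        ext ω
        simp
      rw [e2] at ih
      rw [e1, Finset.prod_range_succ, mul_comm, ← ih]
      exact h2.symm
    · intro f hf
      have := hf ⟨n, by simp⟩
      simp only at this
      change (G.stepPMF (f ⟨n, _⟩)).toMeasure {a (n + 1)} = _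
      rw [this, PMF.toMeasure_apply_singleton _ _ (measurableSet_singleton _)]
      rfl

/-- The `n`-step transition probability `P_n(x,y) = ℙ(X_n = y | X_0 = x)`. -/
noncomputable def P (n : ℕ) (x y : Γ) : ℝ := (G.law x).real {ω | ω n = y}

/-- The heat kernel `p_n(x,y) = P_n(x,y) / μ(y)`. -/
noncomputable def p (n : ℕ) (x y : Γ) : ℝ := G.P n x y / G.mass y

/-- The exit time `T_A = min {k : X_k ∉ A}` (infinite if the trajectory stays in `A`). -/
noncomputable def exitTime (A : Set Γ) (ω : ℕ → Γ) : ℝ≥0∞ := ⨅ (k : ℕ) (_ : ω k ∉ A), (k : ℝ≥0∞)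

/-- The mean exit time `E(x,R) = 𝔼(T_{B(x,R)} | X_0 = x)`. -/
noncomputable def E (x : Γ) (R : ℝ) : ℝ := (∫⁻ ω, exitTime (G.ball x R) ω ∂G.law x).toReal

/-- The inverse `e(x,n) = min {R ∈ ℕ : E(x,R) ≥ n}` of the mean exit time. -/
noncomputable def e (x : Γ) (n : ℕ) : ℕ := sInf {R : ℕ | (n : ℝ) ≤ G.E x R}

/-- The time comparison principle `(TC)`. -/
def TimeComparison : Prop :=
  ∃ C : ℝ, 1 < C ∧ ∀ (x : Γ) (R : ℝ), 0 < R → ∀ y ∈ G.ball x R, G.E x (2 * R) / G.E y R ≤ C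

/-- The local diagonal upper estimate `(DUE)`. -/
def DiagonalUpperEstimate : Prop :=
  ∃ C : ℝ, 0 < C ∧ ∀ (x : Γ) (n : ℕ), 0 < n → G.p n x x ≤ C / G.V x (G.e x n)

/-- The upper estimate `(UE)`. -/
def UpperEstimate : Prop :=
  ∃ C β c : ℝ, 1 < C ∧ 1 < β ∧ 0 < c ∧ ∀ (x y : Γ) (n : ℕ), 0 < n →
    G.p n x y ≤ C / G.V x (G.e x n) *
      Real.exp (-c * (G.E x (G.graph.dist x y) / n) ^ (1 / (β - 1)))

end Walk

/-- The controlled weights condition `(p₀)`. -/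
def ControlledWeights : Prop :=
  ∃ p₀ : ℝ, 0 < p₀ ∧ ∀ x y, 0 < G.weight x y → p₀ ≤ (G.weight x y : ℝ) / G.mass x

/-- The volume doubling property `(VD)`. -/
def VolumeDoubling : Prop :=
  ∃ D : ℝ, 0 < D ∧ ∀ (x : Γ) (R : ℝ), 0 < R → G.V x (2 * R) ≤ D * G.V x R

end WeightedGraph

/-! ### Transition operators, mean exit times and the law of the walk -/

namespace WeightedGraph

open MeasureTheory ProbabilityTheory Filter Topology

variable {Γ : Type*} (G : WeightedGraph Γ)

/-! Split `p_{k+l}(x,y)` at the midpoint time `k ≈ n/2`. If `2r ≤ d(x,y)`, the position at that time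
lies outside `B(x,r)` or outside `B(y,r)`, and by reversibility the two cases are alike. Decomposing
at the first exit from the ball bounds each by a supremum `S` of heat kernels at times at least
about `n/2`, times the probability of leaving a ball of radius `r ≈ d/2` by time `n`
(`heat_le_exitBy`).

Exit probabilities. (TC) makes the mean exit time from `B(z,r)` comparable with its maximum over
starting points, so `1 - τ/(2K)` is almost superharmonic and each crossing of a ball gains a fixed
factor below 1. Leaving `B(x,R)` requires about `2^i` crossings of balls of radius `R/2^i`.
Balancing this gain against the cost of time through the choice of `i` yields `exp(1 - c
Z^{1/(β-1)})`, with `Z = E/n`, `β = log₂ C` and `C` the constant of `TimeRegular`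
(`TimeRegular.exitBy_ball_le`).

The supremum. Chapman–Kolmogorov and symmetry reduce `S` to diagonal values, which (DUE) bounds by
`1/V(u,e(u,m))` at nearby `u`. (VD) together with the geometric growth of `E` moves this to
`1/V(x,e(x,n))` at the price of a power of `1 + Z` (`TimeRegular.V_e_le`), and half of the
exponential absorbs that power. -/

/-- The transition operator `f ↦ ∑ P(x,y) f(y)`. -/
noncomputable def avg (f : Γ → ℝ≥0∞) (x : Γ) : ℝ≥0∞ := ∑' y, (G.prob x y : ℝ≥0∞) * f y

/-- The transition operator of the walk killed outside `A`. -/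
noncomputable def kill (A : Set Γ) (f : Γ → ℝ≥0∞) : Γ → ℝ≥0∞ := A.indicator (G.avg f)

theorem avg_le_avg {f g : Γ → ℝ≥0∞} {x : Γ} (h : ∀ y, G.prob x y ≠ 0 → f y ≤ g y) :
    G.avg f x ≤ G.avg g x := by
  refine ENNReal.tsum_le_tsum fun y => ?_
  by_cases hy : G.prob x y = 0
  · simp [hy]
  · gcongr
    exact h y hy

theorem avg_add (f g : Γ → ℝ≥0∞) (x : Γ) :
    G.avg (fun y => f y + g y) x = G.avg f x + G.avg g x := by
  simp only [avg, mul_add, ENNReal.tsum_add]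

theorem avg_const_mul (c : ℝ≥0∞) (f : Γ → ℝ≥0∞) (x : Γ) :
    G.avg (fun y => c * f y) x = c * G.avg f x := by
  simp only [avg, ← ENNReal.tsum_mul_left]
  exact tsum_congr fun y => by ring

theorem avg_mul_const (c : ℝ≥0∞) (f : Γ → ℝ≥0∞) (x : Γ) :
    G.avg (fun y => f y * c) x = G.avg f x * c := by
  simp only [mul_comm _ c, avg_const_mul]

theorem avg_const [Nontrivial Γ] (c : ℝ≥0∞) (x : Γ) : G.avg (fun _ => c) x = c := by
  simp only [avg, ENNReal.tsum_mul_right, (G.hasSum_prob x).tsum_eq, one_mul]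

theorem avg_tsum {ι : Type*} (f : ι → Γ → ℝ≥0∞) (x : Γ) :
    G.avg (fun y => ∑' i, f i y) x = ∑' i, G.avg (f i) x := by
  simp only [avg, ← ENNReal.tsum_mul_left]
  exact ENNReal.tsum_comm

theorem kill_univ : G.kill Set.univ = G.avg := by
  ext f x
  simp [kill]

theorem kill_of_mem {A : Set Γ} {x : Γ} (hx : x ∈ A) (f : Γ → ℝ≥0∞) :
    G.kill A f x = G.avg f x := Set.indicator_of_mem hx _

theorem kill_of_notMem {A : Set Γ} {x : Γ} (hx : x ∉ A) (f : Γ → ℝ≥0∞) :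
    G.kill A f x = 0 := Set.indicator_of_notMem hx _

/-- The mean exit time of `A`, as a sum of survival probabilities. -/
noncomputable def meanExit (A : Set Γ) (x : Γ) : ℝ≥0∞ :=
  ∑' k : ℕ, (G.kill A)^[k + 1] (fun _ => 1) x

theorem meanExit_of_notMem {A : Set Γ} {x : Γ} (hx : x ∉ A) : G.meanExit A x = 0 := by
  simp [meanExit, Function.iterate_succ_apply', kill_of_notMem G hx]

theorem meanExit_of_mem [Nontrivial Γ] {A : Set Γ} {x : Γ} (hx : x ∈ A) :
    G.meanExit A x = 1 + G.avg (G.meanExit A) x := by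
  have h : G.avg (G.meanExit A) x = ∑' k : ℕ, (G.kill A)^[k + 1 + 1] (fun _ => 1) x := by
    have := G.avg_tsum (fun k : ℕ => (G.kill A)^[k + 1] (fun _ => 1)) x
    simp only [Function.iterate_succ_apply' _ (_ + 1), kill_of_mem G hx]
    exact this
  rw [h, meanExit, tsum_eq_zero_add' ENNReal.summable]
  simp only [zero_add, Function.iterate_one, kill_of_mem G hx, avg_const]

theorem one_le_meanExit [Nontrivial Γ] {A : Set Γ} {x : Γ} (hx : x ∈ A) : 1 ≤ G.meanExit A x := by
  rw [meanExit_of_mem G hx]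
  exact le_self_add

/-- A supersolution bounds the mean exit time. -/
theorem meanExit_le_of_supersolution [Nontrivial Γ] {A : Set Γ} {ψ : Γ → ℝ≥0∞}
    (h : ∀ x ∈ A, 1 + G.avg ψ x ≤ ψ x) (x : Γ) : G.meanExit A x ≤ ψ x := by
  -- The mean exit time is the least nonnegative supersolution: its partial sums are the iterates
  -- started from 0.
  have key : ∀ n : ℕ, ∀ x, ∑ k ∈ Finset.range n, (G.kill A)^[k + 1] (fun _ => 1) x ≤ ψ x := by
    intro n
    induction n with
    | zero => simp
    | succ n ih =>
      intro x
      by_cases hx : x ∈ A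
      · refine le_trans ?_ (h x hx)
        rw [Finset.sum_range_succ', add_comm]
        refine add_le_add ?_ ?_
        · simp [kill_of_mem G hx, avg_const]
        · refine le_trans (le_of_eq ?_) (G.avg_le_avg fun y _ => ih y)
          simp only [Function.iterate_succ_apply' _ (_ + 1), kill_of_mem G hx]
          simp only [avg, Finset.mul_sum]
          exact (Summable.tsum_finsetSum fun _ _ => ENNReal.summable).symm
      · simp [Function.iterate_succ_apply', kill_of_notMem G hx]
  rw [meanExit, ENNReal.tsum_eq_iSup_nat]
  exact iSup_le fun n => key n x

/-- `T = ∑ 1{T > k}`, where `T > k` means that the positions at times `0, …, k` all lie in `A`. Both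
sides are infinite on a path that never leaves. -/
theorem exitTime_eq_tsum (A : Set Γ) (ω : ℕ → Γ) :
    exitTime A ω = ∑' k : ℕ, {ω : ℕ → Γ | ∀ i < k + 1, ω i ∈ A}.indicator (fun _ => 1) ω := by
  by_cases h : ∃ k, ω k ∉ A
  · classical
    have hN := Nat.find_spec h
    have hlt : ∀ i < Nat.find h, ω i ∈ A := fun i hi => not_not.1 (Nat.find_min h hi)
    set N := Nat.find h
    have hL : exitTime A ω = N := by
      refine le_antisymm (iInf₂_le N hN) (le_iInf₂ fun k hk => ?_)
      exact_mod_cast not_lt.1 fun hlt' => hk (hlt k hlt')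
    rw [hL, tsum_eq_sum (s := Finset.range N)]
    · rw [Finset.sum_congr rfl (g := fun _ => 1)]
      · simp
      · intro k hk
        rw [Set.indicator_of_mem]
        intro i hi
        exact hlt i (by simp at hk; omega)
    · intro k hk
      rw [Set.indicator_of_notMem]
      intro hall
      exact hN (hall N (by simp at hk; omega))
  · push Not at h
    simp [exitTime, h]

set_option linter.unusedSectionVars false

section Walk

variable [MeasurableSpace Γ] [DiscreteMeasurableSpace Γ] [Countable Γ] [Nontrivial Γ]

theorem lintegral_stepPMF (f : Γ → ℝ≥0∞) (x : Γ) :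
    ∫⁻ y, f y ∂(G.stepPMF x).toMeasure = G.avg f x := by
  rw [lintegral_countable', avg]
  refine tsum_congr fun y => ?_
  rw [PMF.toMeasure_apply_singleton _ _ (measurableSet_singleton _), mul_comm]
  rfl

theorem lintegral_law_zero (f : Γ → ℝ≥0∞) (x : Γ) : ∫⁻ ω, f (ω 0) ∂G.law x = f x := by
  have h := Kernel.traj_map_frestrictLe_apply (X := fun _ => Γ) (κ := G.stepKernel) 0 0
    (fun _ => x)
  rw [Kernel.partialTraj_self, Kernel.id_apply] at h
  have hm : Measurable fun g : (Finset.Iic 0) → Γ => f (g ⟨0, by simp⟩) :=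
    (Measurable.of_discrete (f := f)).comp (measurable_pi_apply _)
  have h2 := congrArg (fun m => ∫⁻ g, f (g ⟨0, by simp⟩) ∂m) h
  rw [lintegral_map hm (by fun_prop), lintegral_dirac' _ hm] at h2
  exact h2

/-- The Markov property at time `n`, tested on an event of the past. -/
theorem lintegral_law_succ (n : ℕ) (S : Set Γ) (g : Γ → ℝ≥0∞) (x : Γ) :
    ∫⁻ ω, {ω : ℕ → Γ | ∀ i < n + 1, ω i ∈ S}.indicator (fun ω => g (ω (n + 1))) ω ∂G.law x =
    ∫⁻ ω, {ω : ℕ → Γ | ∀ i < n + 1, ω i ∈ S}.indicator (fun ω => G.avg g (ω n)) ω ∂G.law x := by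
  have h := Kernel.partialTraj_compProd_eq_map_traj (X := fun _ => Γ)
    (κ := G.stepKernel) (Nat.zero_le n) (x₀ := fun _ => x)
  set T : Set ((Finset.Iic n) → Γ) := {f | ∀ i, f i ∈ S} with hT
  have hTm : MeasurableSet T := by
    rw [hT, Set.ofPred_forall]
    exact MeasurableSet.iInter fun i => measurable_pi_apply i (MeasurableSet.of_discrete (s := S))
  have hg : Measurable g := Measurable.of_discrete
  have hga : Measurable (G.avg g) := Measurable.of_discrete
  set F : ((Finset.Iic n) → Γ) × Γ → ℝ≥0∞ := fun q => T.indicator (fun _ => g q.2) q.1 with hF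
  have hFm : Measurable F := by
    have : F = (Prod.fst ⁻¹' T).indicator fun q => g q.2 := by
      rfl
    rw [this]
    exact (hg.comp measurable_snd).indicator (measurable_fst hTm)
  have hmem : ∀ ω : ℕ → Γ, Preorder.frestrictLe (π := fun _ => Γ) n ω ∈ T ↔
      ω ∈ {ω : ℕ → Γ | ∀ i < n + 1, ω i ∈ S} := by
    intro ω
    simp [hT]
  have h2 := congrArg (fun m => ∫⁻ q, F q ∂m) h
  rw [Measure.lintegral_compProd hFm, lintegral_map hFm (by fun_prop)] at h2
  have h3 : ∀ f : (Finset.Iic n) → Γ, ∫⁻ y, F (f, y) ∂(G.stepKernel n f) =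
      T.indicator (fun f => G.avg g (f ⟨n, by simp⟩)) f := by
    intro f
    by_cases hf : f ∈ T
    · simp only [hF, Set.indicator_of_mem hf]
      exact G.lintegral_stepPMF g _
    · simp [hF, Set.indicator_of_notMem hf]
  simp only [h3] at h2
  rw [← Kernel.traj_map_frestrictLe_apply, lintegral_map ?_ (by fun_prop)] at h2
  · refine Eq.trans ?_ (h2.symm.trans ?_)
    · refine lintegral_congr fun ω => ?_
      by_cases hω : ω ∈ {ω : ℕ → Γ | ∀ i < n + 1, ω i ∈ S}
      · simp only [hF, Set.indicator_of_mem hω, Set.indicator_of_mem ((hmem ω).2 hω)]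
      · simp only [hF, Set.indicator_of_notMem hω,
          Set.indicator_of_notMem (fun h => hω ((hmem ω).1 h))]
    · refine lintegral_congr fun ω => ?_
      by_cases hω : ω ∈ {ω : ℕ → Γ | ∀ i < n + 1, ω i ∈ S}
      · rw [Set.indicator_of_mem hω, Set.indicator_of_mem ((hmem ω).2 hω)]
        rfl
      · rw [Set.indicator_of_notMem hω,
          Set.indicator_of_notMem (fun h => hω ((hmem ω).1 h))]
  · exact (hga.comp (measurable_pi_apply _)).indicator hTm

/-- The bridge from trajectories to operators. The position at time `n` is left unconstrained, so `S
= univ` gives transition probabilities and `g = 1` gives survival probabilities. -/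
theorem lintegral_law_kill (n : ℕ) (S : Set Γ) (g : Γ → ℝ≥0∞) (x : Γ) :
    ∫⁻ ω, {ω : ℕ → Γ | ∀ i < n, ω i ∈ S}.indicator (fun ω => g (ω n)) ω ∂G.law x =
      (G.kill S)^[n] g x := by
  induction n generalizing g with
  | zero => simpa using G.lintegral_law_zero g x
  | succ n ih =>
    rw [lintegral_law_succ, Function.iterate_succ_apply, ← ih]
    refine lintegral_congr fun ω => ?_
    by_cases hω : ω ∈ {ω : ℕ → Γ | ∀ i < n, ω i ∈ S}
    · rw [Set.indicator_of_mem hω]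
      by_cases hn : ω n ∈ S
      · rw [Set.indicator_of_mem, kill_of_mem G hn]
        intro i hi
        rcases Nat.lt_succ_iff_lt_or_eq.1 hi with hi | rfl
        exacts [hω i hi, hn]
      · rw [Set.indicator_of_notMem, kill_of_notMem G hn]
        exact fun h => hn (h n n.lt_succ_self)
    · rw [Set.indicator_of_notMem hω, Set.indicator_of_notMem]
      exact fun h => hω fun i hi => h i (Nat.lt_succ_of_lt hi)

theorem lintegral_exitTime (A : Set Γ) (x : Γ) :
    ∫⁻ ω, exitTime A ω ∂G.law x = G.meanExit A x := by
  simp only [exitTime_eq_tsum]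
  rw [lintegral_tsum]
  · exact tsum_congr fun k => G.lintegral_law_kill (k + 1) A (fun _ => 1) x
  · intro k
    refine (measurable_const.indicator ?_).aemeasurable
    rw [Set.ofPred_forall]
    refine MeasurableSet.iInter fun i => ?_
    rw [Set.ofPred_forall]
    exact MeasurableSet.iInter fun _ =>
      measurable_pi_apply i (MeasurableSet.of_discrete (s := A))

theorem E_eq (x : Γ) (R : ℝ) : G.E x R = (G.meanExit (G.ball x R) x).toReal := by
  rw [E, lintegral_exitTime]

theorem meanExit_mono {A B : Set Γ} (h : A ⊆ B) (x : Γ) : G.meanExit A x ≤ G.meanExit B x := by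
  simp only [← lintegral_exitTime]
  refine lintegral_mono fun ω => ?_
  exact le_iInf₂ fun k hk => iInf₂_le k fun hA => hk (h hA)

end Walk

/-- The `n`-step transition probability, as an iterate of the transition operator. -/
noncomputable def stepProb (n : ℕ) (x y : Γ) : ℝ≥0∞ := G.avg^[n] (({y} : Set Γ).indicator 1) x

theorem P_eq [MeasurableSpace Γ] [DiscreteMeasurableSpace Γ] [Countable Γ] [Nontrivial Γ]
    (n : ℕ) (x y : Γ) : G.P n x y = (G.stepProb n x y).toReal := by
  have h := G.lintegral_law_kill n Set.univ (({y} : Set Γ).indicator 1) x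
  rw [kill_univ, ← stepProb] at h
  rw [P, Measure.real, ← h, ← lintegral_indicator_one]
  · congr 1
    refine lintegral_congr fun ω => ?_
    rw [Set.indicator_of_mem
      (show ω ∈ {ω : ℕ → Γ | ∀ i < n, ω i ∈ Set.univ} from fun _ _ => trivial)]
    rfl
  · exact (measurable_pi_apply (X := fun _ => Γ) n) (MeasurableSet.of_discrete (s := {y}))

end WeightedGraph

/-! ### The heat kernel and its first-exit decomposition -/

namespace WeightedGraph

open MeasureTheory ProbabilityTheory Filter Topology

variable {Γ : Type*} (G : WeightedGraph Γ)

theorem stepProb_zero_self (x : Γ) : G.stepProb 0 x x = 1 := by simp [stepProb]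

theorem stepProb_zero_of_ne {x y : Γ} (h : x ≠ y) : G.stepProb 0 x y = 0 := by
  simp [stepProb, h]

theorem stepProb_succ (n : ℕ) (x y : Γ) :
    G.stepProb (n + 1) x y = G.avg (fun z => G.stepProb n z y) x := by
  simp only [stepProb, Function.iterate_succ_apply']

theorem iterate_avg_le {f g : Γ → ℝ≥0∞} (h : ∀ y, f y ≤ g y) (n : ℕ) (x : Γ) :
    G.avg^[n] f x ≤ G.avg^[n] g x := by
  induction n generalizing x with
  | zero => exact h x
  | succ n ih =>
    simp only [Function.iterate_succ_apply']
    exact G.avg_le_avg fun y _ => ih y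

theorem iterate_avg_eq_tsum (n : ℕ) (f : Γ → ℝ≥0∞) (x : Γ) :
    G.avg^[n] f x = ∑' z, G.stepProb n x z * f z := by
  induction n generalizing x with
  | zero =>
    rw [tsum_eq_single x, stepProb_zero_self]
    · simp
    · intro z hz
      rw [stepProb_zero_of_ne G hz.symm, zero_mul]
  | succ n ih =>
    have h : G.avg^[n] f = fun x => ∑' z, G.stepProb n x z * f z := funext ih
    rw [Function.iterate_succ_apply', h, avg_tsum]
    simp only [avg_mul_const, stepProb_succ]

theorem stepProb_add (m n : ℕ) (x y : Γ) :
    G.stepProb (m + n) x y = ∑' z, G.stepProb m x z * G.stepProb n z y := by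
  rw [stepProb, Function.iterate_add_apply, iterate_avg_eq_tsum]
  rfl

theorem stepProb_one (x y : Γ) : G.stepProb 1 x y = G.prob x y := by
  rw [stepProb_succ, avg, tsum_eq_single y, stepProb_zero_self, mul_one]
  intro z hz
  rw [stepProb_zero_of_ne G hz, mul_zero]

theorem mass_ne_zero [Nontrivial Γ] (x : Γ) : (G.mass x : ℝ≥0∞) ≠ 0 := by
  simpa using (G.mass_pos x).ne'

theorem mass_mul_prob [Nontrivial Γ] (x y : Γ) :
    (G.mass x : ℝ≥0∞) * G.prob x y = G.mass y * G.prob y x := by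
  have h : ∀ x y, G.mass x * G.prob x y = G.weight x y := fun x y => by
    rw [prob, mul_div_cancel₀ _ (G.mass_pos x).ne']
  rw [← ENNReal.coe_mul, ← ENNReal.coe_mul, h, h, G.weight_symm]

theorem mass_mul_stepProb [Nontrivial Γ] (n : ℕ) (x y : Γ) :
    (G.mass x : ℝ≥0∞) * G.stepProb n x y = G.mass y * G.stepProb n y x := by
  induction n generalizing x y with
  | zero =>
    rcases eq_or_ne x y with rfl | h
    · rfl
    · rw [stepProb_zero_of_ne G h, stepProb_zero_of_ne G h.symm, mul_zero, mul_zero]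
  | succ n ih =>
    rw [stepProb_add _ n 1 y x, stepProb_succ, avg, ← ENNReal.tsum_mul_left,
      ← ENNReal.tsum_mul_left]
    refine tsum_congr fun z => ?_
    rw [stepProb_one, ← mul_assoc, ← mul_assoc, mass_mul_prob, ← ih z y]
    ring

theorem stepProb_le_one [Nontrivial Γ] (n : ℕ) (x y : Γ) : G.stepProb n x y ≤ 1 := by
  induction n generalizing x with
  | zero =>
    rcases eq_or_ne x y with rfl | h
    · rw [stepProb_zero_self]
    · rw [stepProb_zero_of_ne G h]
      exact zero_le
  | succ n ih =>
    rw [stepProb_succ]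
    exact (G.avg_le_avg fun z _ => ih z).trans_eq (G.avg_const 1 x)

/-- The heat kernel with values in `ℝ≥0∞`. -/
noncomputable def heat (n : ℕ) (x y : Γ) : ℝ≥0∞ := G.stepProb n x y / G.mass y

theorem p_eq [MeasurableSpace Γ] [DiscreteMeasurableSpace Γ] [Countable Γ] [Nontrivial Γ]
    (n : ℕ) (x y : Γ) : G.p n x y = (G.heat n x y).toReal := by
  rw [p, P_eq, heat, ENNReal.toReal_div, ENNReal.coe_toReal]

theorem heat_ne_top [Nontrivial Γ] (n : ℕ) (x y : Γ) : G.heat n x y ≠ ∞ :=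
  ENNReal.div_ne_top ((G.stepProb_le_one n x y).trans_lt ENNReal.one_lt_top).ne (G.mass_ne_zero y)

theorem heat_mul_mass [Nontrivial Γ] (n : ℕ) (x y : Γ) :
    G.heat n x y * G.mass y = G.stepProb n x y :=
  ENNReal.div_mul_cancel (G.mass_ne_zero y) ENNReal.coe_ne_top

theorem heat_symm [Nontrivial Γ] (n : ℕ) (x y : Γ) : G.heat n x y = G.heat n y x := by
  have h := G.mass_mul_stepProb n x y
  rw [← heat_mul_mass, ← heat_mul_mass, mul_left_comm, mul_left_comm (G.mass y : ℝ≥0∞),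
    mul_comm (G.mass y : ℝ≥0∞)] at h
  refine (ENNReal.mul_left_inj (mul_ne_zero (G.mass_ne_zero x) (G.mass_ne_zero y)) ?_).1 h
  exact ENNReal.mul_ne_top ENNReal.coe_ne_top ENNReal.coe_ne_top

theorem iterate_avg_heat (m l : ℕ) (x y : Γ) :
    G.avg^[m] (fun z => G.heat l z y) x = G.heat (m + l) x y := by
  rw [iterate_avg_eq_tsum]
  simp only [heat, div_eq_mul_inv, ← mul_assoc, ENNReal.tsum_mul_right]
  rw [stepProb_add]

theorem heat_add [Nontrivial Γ] (m n : ℕ) (x y : Γ) :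
    G.heat (m + n) x y = ∑' z, G.heat m x z * G.mass z * G.heat n z y := by
  rw [← iterate_avg_heat, iterate_avg_eq_tsum]
  simp only [heat_mul_mass]

/-- By symmetry, Chapman–Kolmogorov reads as an inner product; `ab ≤ a² + b²` termwise then plays
the role of Cauchy–Schwarz. -/
theorem heat_add_le [Nontrivial Γ] (a b : ℕ) (u v : Γ) :
    G.heat (a + b) u v ≤ G.heat (a + a) u u + G.heat (b + b) v v := by
  rw [heat_add, heat_add, heat_add, ← ENNReal.tsum_add]
  refine ENNReal.tsum_le_tsum fun z => ?_
  rw [G.heat_symm a z u, G.heat_symm b v z]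
  rcases le_total (G.heat a u z) (G.heat b z v) with h | h
  · refine le_trans ?_ le_add_self
    gcongr
  · refine le_trans ?_ le_self_add
    gcongr

theorem dist_le_one_of_prob_ne_zero {x y : Γ} (h : G.prob x y ≠ 0) : G.graph.dist x y ≤ 1 := by
  rcases eq_or_ne x y with rfl | hne
  · simp
  · refine le_of_eq (SimpleGraph.dist_eq_one_iff_adj.2 ?_)
    rw [graph, SimpleGraph.fromRel_adj]
    refine ⟨hne, Or.inl (pos_iff_ne_zero.2 fun h0 => h ?_)⟩
    rw [prob, h0, zero_div]

theorem dist_triangle (x y z : Γ) :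
    G.graph.dist x z ≤ G.graph.dist x y + G.graph.dist y z :=
  SimpleGraph.Connected.dist_triangle G.connected

theorem stepProb_eq_zero_of_lt_dist {n : ℕ} {x y : Γ} (h : n < G.graph.dist x y) :
    G.stepProb n x y = 0 := by
  induction n generalizing x with
  | zero =>
    refine stepProb_zero_of_ne G ?_
    rintro rfl
    simp at h
  | succ n ih =>
    rw [stepProb_succ, avg, ENNReal.tsum_eq_zero]
    intro z
    by_cases hz : G.prob x z = 0
    · simp [hz]
    · have := G.dist_le_one_of_prob_ne_zero hz
      have := G.dist_triangle x z y
      rw [ih (by omega), mul_zero]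

theorem mem_ball_natCast {x y : Γ} {r : ℕ} : y ∈ G.ball x r ↔ G.graph.dist x y < r := by
  simp [ball]

open Classical in
/-- The probability that the walk leaves `A` by time `n`. -/
noncomputable def exitBy (A : Set Γ) : ℕ → Γ → ℝ≥0∞
  | 0, x => if x ∈ A then 0 else 1
  | n + 1, x => if x ∈ A then G.avg (exitBy A n) x else 1

theorem exitBy_of_notMem {A : Set Γ} {x : Γ} (hx : x ∉ A) (n : ℕ) : G.exitBy A n x = 1 := by
  cases n <;> simp [exitBy, hx]

theorem exitBy_zero_of_mem {A : Set Γ} {x : Γ} (hx : x ∈ A) : G.exitBy A 0 x = 0 := by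
  simp [exitBy, hx]

theorem exitBy_succ_of_mem {A : Set Γ} {x : Γ} (hx : x ∈ A) (n : ℕ) :
    G.exitBy A (n + 1) x = G.avg (G.exitBy A n) x := by
  simp [exitBy, hx]

theorem exitBy_le_one [Nontrivial Γ] (A : Set Γ) (n : ℕ) (x : Γ) : G.exitBy A n x ≤ 1 := by
  by_cases hx : x ∈ A
  · cases n with
    | zero => simp [exitBy_zero_of_mem G hx]
    | succ n =>
      rw [exitBy_succ_of_mem G hx]
      exact (G.avg_le_avg fun z _ => exitBy_le_one A n z).trans_eq (G.avg_const 1 x)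
  · rw [exitBy_of_notMem G hx]

theorem exitBy_le_succ [Nontrivial Γ] (A : Set Γ) (n : ℕ) (x : Γ) :
    G.exitBy A n x ≤ G.exitBy A (n + 1) x := by
  by_cases hx : x ∈ A
  · cases n with
    | zero => simp [exitBy_zero_of_mem G hx]
    | succ n =>
      rw [exitBy_succ_of_mem G hx, exitBy_succ_of_mem G hx]
      exact G.avg_le_avg fun z _ => exitBy_le_succ A n z
  · rw [exitBy_of_notMem G hx, exitBy_of_notMem G hx]

theorem exitBy_add_survival [Nontrivial Γ] (A : Set Γ) (n : ℕ) (x : Γ) :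
    G.exitBy A n x + (G.kill A)^[n + 1] (fun _ => 1) x = 1 := by
  induction n generalizing x with
  | zero =>
    by_cases hx : x ∈ A
    · simp [exitBy_zero_of_mem G hx, kill_of_mem G hx, avg_const]
    · simp [exitBy_of_notMem G hx, kill_of_notMem G hx]
  | succ n ih =>
    by_cases hx : x ∈ A
    · rw [exitBy_succ_of_mem G hx, Function.iterate_succ_apply', kill_of_mem G hx, ← avg_add]
      simp only [ih, avg_const]
    · rw [exitBy_of_notMem G hx, Function.iterate_succ_apply', kill_of_notMem G hx, add_zero]

/-- First-exit decomposition over a ball: the contribution to a heat kernel of the paths that are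
outside the ball at time `k`. -/
theorem tsum_compl_ball_le [Nontrivial Γ] {x y : Γ} {r k l : ℕ} {S : ℝ≥0∞}
    (hS : ∀ u, G.graph.dist x u ≤ r → ∀ j ≤ k, G.heat (j + l) u y ≤ S) :
    ∑' z, (G.ball x r)ᶜ.indicator (fun z => G.heat k x z * G.mass z * G.heat l z y) z ≤
      S * G.exitBy (G.ball x r) k x := by
  set A := G.ball x r with hA
  -- Induction on the time left replaces the strong Markov property. Points at distance exactly `r`
  -- are included because the walk exits onto them; from there the remaining sum is at most a full
  -- heat kernel, hence at most `S`.
  have key : ∀ m ≤ k, ∀ z, G.graph.dist x z ≤ r →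
      G.avg^[m] (Aᶜ.indicator fun z => G.heat l z y) z ≤ S * G.exitBy A m z := by
    intro m
    induction m with
    | zero =>
      intro _ z hz
      by_cases hzA : z ∈ A
      · simp [hzA]
      · rw [exitBy_of_notMem G hzA, mul_one]
        refine (Set.indicator_le_self _ _ _).trans ?_
        simpa using hS z hz 0 (Nat.zero_le _)
    | succ m ih =>
      intro hm z hz
      by_cases hzA : z ∈ A
      · rw [Function.iterate_succ_apply', exitBy_succ_of_mem G hzA, ← avg_const_mul]
        refine G.avg_le_avg fun v hv => ih (by omega) v ?_
        have h1 := G.mem_ball_natCast.1 hzA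
        have h2 := G.dist_le_one_of_prob_ne_zero hv
        have h3 := G.dist_triangle x z v
        omega
      · rw [exitBy_of_notMem G hzA, mul_one]
        refine (G.iterate_avg_le (fun v => Set.indicator_le_self _ _ _) _ _).trans ?_
        rw [iterate_avg_heat]
        exact hS z hz _ hm
  refine le_trans (le_of_eq ?_) (key k le_rfl x (by simp))
  rw [iterate_avg_eq_tsum]
  refine tsum_congr fun z => ?_
  by_cases hz : z ∈ A
  · simp [hz]
  · simp [hz, heat_mul_mass]

/-- The two balls are disjoint, so the position at time `k` is outside one of them; in the second
case the path is read backwards from `y`. -/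
theorem heat_le_exitBy [Nontrivial Γ] {x y : Γ} {r k l : ℕ} {S : ℝ≥0∞}
    (hd : 2 * r ≤ G.graph.dist x y)
    (hx : ∀ u, G.graph.dist x u ≤ r → ∀ j ≤ k, G.heat (j + l) u y ≤ S)
    (hy : ∀ u, G.graph.dist y u ≤ r → ∀ j ≤ l, G.heat (j + k) u x ≤ S) :
    G.heat (k + l) x y ≤
      S * (G.exitBy (G.ball x r) k x + G.exitBy (G.ball y r) l y) := by
  rw [mul_add]
  refine le_trans ?_ (add_le_add (G.tsum_compl_ball_le hx) (G.tsum_compl_ball_le hy))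
  rw [heat_add, ← ENNReal.tsum_add]
  refine ENNReal.tsum_le_tsum fun z => ?_
  by_cases hz : z ∈ G.ball x r
  · refine le_trans ?_ le_add_self
    rw [Set.indicator_of_mem, G.heat_symm k x z, G.heat_symm l z y]
    · exact le_of_eq (by ring)
    · intro hz'
      have h1 := G.mem_ball_natCast.1 hz
      have h2 := G.mem_ball_natCast.1 hz'
      have h3 := G.dist_triangle x z y
      rw [SimpleGraph.dist_comm] at h2
      omega
  · rw [Set.indicator_of_mem (by exact hz)]
    exact le_self_add

end WeightedGraph

/-! ### Finiteness of balls and of mean exit times -/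

namespace WeightedGraph

open MeasureTheory ProbabilityTheory Filter Topology

variable {Γ : Type*} (G : WeightedGraph Γ)

theorem exists_adj_dist_succ {x o : Γ} (h : x ≠ o) :
    ∃ y, 0 < G.weight x y ∧ G.graph.dist x o = G.graph.dist y o + 1 := by
  obtain ⟨p, hp⟩ := (G.connected.preconnected x o).exists_walk_length_eq_dist
  cases p with
  | nil => exact absurd rfl h
  | @cons _ y _ hadj q =>
    have hw : 0 < G.weight x y := by
      rw [SimpleGraph.fromRel_adj] at hadj
      rcases hadj.2 with h | h
      · exact h
      · rwa [G.weight_symm]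
    refine ⟨y, hw, ?_⟩
    have h1 : G.graph.dist y o ≤ q.length := SimpleGraph.dist_le q
    have h2 : q.length + 1 = G.graph.dist x o := hp
    have h3 : G.graph.dist x y ≤ 1 := by
      refine le_of_eq (SimpleGraph.dist_eq_one_iff_adj.2 hadj)
    have h4 := G.dist_triangle x y o
    omega

theorem exists_weight_pos [Nontrivial Γ] (x : Γ) : ∃ y, y ≠ x ∧ 0 < G.weight x y := by
  obtain ⟨o, ho⟩ := exists_ne x
  obtain ⟨y, hy, hd⟩ := G.exists_adj_dist_succ ho.symm
  refine ⟨y, ?_, hy⟩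
  rintro rfl
  omega

section Controlled

variable {G}

theorem finite_neighbors [Nontrivial Γ] {q : ℝ≥0} (hq : 0 < q)
    (hG : ∀ x y, 0 < G.weight x y → q ≤ G.prob x y) (x : Γ) : {y | 0 < G.weight x y}.Finite := by
  have hs : Summable (G.prob x) := ((G.summable_weight x).hasSum.div_const (G.mass x)).summable
  have h := (NNReal.tendsto_cofinite_zero_of_summable hs).eventually (gt_mem_nhds hq)
  refine (Filter.eventually_cofinite.1 h).subset fun y hy => ?_
  exact not_lt.2 (hG x y hy)

theorem finite_ball [Nontrivial Γ] {q : ℝ≥0} (hq : 0 < q)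
    (hG : ∀ x y, 0 < G.weight x y → q ≤ G.prob x y) (x : Γ) (n : ℕ) : (G.ball x n).Finite := by
  induction n with
  | zero =>
    convert Set.finite_empty (α := Γ)
    ext y
    rw [mem_ball_natCast]
    simp
  | succ n ih =>
    refine ((Set.finite_singleton x).union
      (ih.biUnion fun y _ => finite_neighbors hq hG y)).subset fun z hz => ?_
    rcases eq_or_ne z x with rfl | hne
    · exact Or.inl rfl
    · obtain ⟨y, hy, hd⟩ := G.exists_adj_dist_succ hne
      refine Or.inr (Set.mem_biUnion (x := y) ?_ ?_)
      · rw [mem_ball_natCast] at hz ⊢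
        rw [SimpleGraph.dist_comm] at hz ⊢
        omega
      · change 0 < G.weight y z
        rwa [G.weight_symm]

/-- Fix `o` outside the finite ball and let `f = θ^{d(·,o)}` with `θ = q/2`. A neighbour nearer to
`o` alone gives `Pf ≥ 2f` away from `o`, so a large multiple of `1 - f` is a supersolution on the
ball. -/
theorem meanExit_ball_ne_top [Infinite Γ] {q : ℝ≥0} (hq : 0 < q)
    (hG : ∀ x y, 0 < G.weight x y → q ≤ G.prob x y) (x : Γ) (n : ℕ) (z : Γ) :
    G.meanExit (G.ball x n) z ≠ ∞ := by
  obtain ⟨o, ho⟩ := (finite_ball hq hG x n).exists_notMem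
  set A := G.ball x n
  obtain ⟨y, hyx, hy⟩ := G.exists_weight_pos x
  have hq1 : (q : ℝ≥0∞) ≤ 1 := by
    rw [← (G.hasSum_prob x).tsum_eq]
    exact le_trans (by exact_mod_cast hG x y hy) (ENNReal.le_tsum y)
  set θ : ℝ≥0∞ := q / 2 with hθ
  have hθq : 2 * θ = q := ENNReal.mul_div_cancel (by simp) (by simp)
  have hθ1 : θ ≤ 1 :=
    le_trans (ENNReal.div_le_of_le_mul (le_mul_of_one_le_right' (by norm_num))) hq1
  have hθ0 : θ ≠ 0 := by simp [hθ, hq.ne']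
  have hθt : θ ≠ ∞ := (hθ1.trans_lt ENNReal.one_lt_top).ne
  set f : Γ → ℝ≥0∞ := fun z => θ ^ G.graph.dist z o with hf
  have hf1 : ∀ z, f z ≤ 1 := fun z => pow_le_one' hθ1 _
  have hft : ∀ z, f z ≠ ∞ := fun z => ((hf1 z).trans_lt ENNReal.one_lt_top).ne
  have hgf : ∀ z, (1 - f z) + f z = 1 := fun z => tsub_add_cancel_of_le (hf1 z)
  set D := n + G.graph.dist x o
  set M : ℝ≥0∞ := (θ ^ D)⁻¹ with hM
  have hMt : M ≠ ∞ := by simp [hM, hθ0]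
  refine ne_top_of_le_ne_top (ENNReal.mul_ne_top hMt ENNReal.one_ne_top)
    ((G.meanExit_le_of_supersolution (A := A) (ψ := fun z => M * (1 - f z)) ?_ z).trans ?_)
  · intro z hz
    have hzo : z ≠ o := by
      rintro rfl
      exact ho hz
    obtain ⟨v, hv, hd⟩ := G.exists_adj_dist_succ hzo
    have h1 : 2 * f z ≤ G.avg f z := by
      refine le_trans ?_ (ENNReal.le_tsum v)
      have : 2 * f z = q * f v := by
        simp only [hf, hd, pow_succ]
        rw [← hθq]
        ring
      rw [this]
      gcongr
      exact_mod_cast hG z v hv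
    have h2 : G.avg (fun z => 1 - f z) z + G.avg f z = 1 := by
      rw [← avg_add]
      simp only [hgf, avg_const]
    have h3 : G.avg (fun z => 1 - f z) z + f z ≤ 1 - f z := by
      refine (ENNReal.add_le_add_iff_right (hft z)).1 ?_
      rw [hgf, add_assoc, ← two_mul]
      exact (add_le_add_right h1 _).trans_eq h2
    have h4 : 1 ≤ M * f z := by
      rw [hM, mul_comm, ← div_eq_mul_inv, ENNReal.le_div_iff_mul_le (by simp [hθ0]) (by simp [hθt]),
        one_mul]
      refine pow_le_pow_right_of_le_one' hθ1 ?_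
      have h5 := G.mem_ball_natCast.1 hz
      have h6 := G.dist_triangle z x o
      rw [SimpleGraph.dist_comm (u := z) (v := x)] at h6
      omega
    calc 1 + G.avg (fun z => M * (1 - f z)) z
        ≤ M * f z + M * G.avg (fun z => 1 - f z) z := by
          rw [avg_const_mul]
          gcongr
      _ = M * (G.avg (fun z => 1 - f z) z + f z) := by ring
      _ ≤ M * (1 - f z) := by gcongr
  · gcongr
    exact tsub_le_self

/-- The ball is `{x}`. A loop may hold the walk there, but each step leaves with probability at
least `q`. -/
theorem meanExit_ball_one_le [Nontrivial Γ] {q : ℝ≥0} (hq : 0 < q)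
    (hG : ∀ x y, 0 < G.weight x y → q ≤ G.prob x y) (x : Γ) :
    G.meanExit (G.ball x (1 : ℕ)) x ≤ (q : ℝ≥0∞)⁻¹ := by
  classical
  refine (G.meanExit_le_of_supersolution
    (ψ := fun z => if z = x then (q : ℝ≥0∞)⁻¹ else 0) ?_ x).trans (by simp)
  intro z hz
  have hzx : z = x := by
    rw [mem_ball_natCast, Nat.lt_one_iff] at hz
    exact ((G.connected.dist_eq_zero_iff).1 hz).symm
  subst hzx
  obtain ⟨y, hyz, hy⟩ := G.exists_weight_pos z
  have h1 : (G.prob z z : ℝ≥0∞) + G.prob z y ≤ 1 := by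
    rw [← (G.hasSum_prob z).tsum_eq]
    have := ENNReal.sum_le_tsum (f := fun y => (G.prob z y : ℝ≥0∞)) {z, y}
    rwa [Finset.sum_pair hyz.symm] at this
  have h2 : G.avg (fun v => if v = z then (q : ℝ≥0∞)⁻¹ else 0) z = G.prob z z * (q : ℝ≥0∞)⁻¹ := by
    rw [avg, tsum_eq_single z]
    · simp
    · intro v hv
      simp [hv]
  have hq' : (q : ℝ≥0∞) * (q : ℝ≥0∞)⁻¹ = 1 :=
    ENNReal.mul_inv_cancel (by simpa using hq.ne') ENNReal.coe_ne_top
  rw [h2]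
  simp only [if_true]
  calc 1 + (G.prob z z : ℝ≥0∞) * (q : ℝ≥0∞)⁻¹
      = ((G.prob z z : ℝ≥0∞) + q) * (q : ℝ≥0∞)⁻¹ := by rw [add_mul, hq', add_comm]
    _ ≤ 1 * (q : ℝ≥0∞)⁻¹ := by
      gcongr
      refine le_trans ?_ h1
      gcongr
      exact hG z y hy
    _ = (q : ℝ≥0∞)⁻¹ := one_mul _

end Controlled

/-! ### Chaining of exit times -/

/-- One step of the chaining argument for exit times. -/
theorem exitBy_le_of_exit_ball [Nontrivial Γ] {z : Γ} {r : ℕ} {B : Set Γ} {K M s : ℝ≥0∞}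
    (hK0 : K ≠ 0) (hKt : K ≠ ∞) (hK : ∀ v, G.meanExit (G.ball z r) v ≤ K)
    (hs : 1 + K⁻¹ ≤ s) (hAB : G.ball z r ⊆ B)
    (hM : ∀ u, G.graph.dist z u ≤ r → ∀ m, G.exitBy B m u ≤ M * s ^ m) (m : ℕ) :
    G.exitBy B m z ≤ M * s ^ m * (1 - G.meanExit (G.ball z r) z * (2 * K)⁻¹) := by
  set A := G.ball z r
  set a : ℝ≥0∞ := (2 * K)⁻¹ with ha
  set τ := G.meanExit A
  -- Since `τ ≤ K`, `φ` lies in `[1/2, 1]`; it is 1 off the ball. Inside, `Pτ = τ - 1` gives `Pφ = φ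
  -- + 1/(2K) ≤ (1 + 1/K) φ`, so `M s^m φ` dominates the exit probability.
  set φ : Γ → ℝ≥0∞ := fun v => 1 - τ v * a with hφ
  have hKa : K * a = 2⁻¹ := by
    rw [ha, ENNReal.mul_inv (by simp) (by simp), mul_left_comm, ENNReal.mul_inv_cancel hK0 hKt,
      mul_one]
  have h2a : 2 * a = K⁻¹ := by
    rw [ha, ENNReal.mul_inv (by simp) (by simp), ← mul_assoc,
      ENNReal.mul_inv_cancel (by simp) (by simp), one_mul]
  have hhalf : ∀ v, τ v * a ≤ 2⁻¹ := fun v => by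
    rw [← hKa]
    gcongr
    exact hK v
  have hsum : ∀ v, φ v + τ v * a = 1 := fun v =>
    tsub_add_cancel_of_le ((hhalf v).trans (by simp))
  have hφ2 : ∀ v, 2⁻¹ ≤ φ v := fun v => by
    rw [hφ]
    refine ENNReal.le_sub_of_add_le_right ((hhalf v).trans_lt (by simp)).ne ?_
    calc 2⁻¹ + τ v * a ≤ 2⁻¹ + 2⁻¹ := by gcongr; exact hhalf v
      _ = 1 := ENNReal.inv_two_add_inv_two
  have hφA : ∀ v ∈ A, G.avg φ v ≤ s * φ v := by
    intro v hv
    have h1 : G.avg φ v + G.avg τ v * a = 1 := by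
      rw [← avg_mul_const, ← avg_add]
      simp only [hsum, avg_const]
    have h2 : G.avg φ v + τ v * a = φ v + a + τ v * a := by
      calc G.avg φ v + τ v * a = (G.avg φ v + G.avg τ v * a) + a := by
            rw [show τ v = 1 + G.avg τ v from G.meanExit_of_mem hv]
            ring
        _ = (φ v + τ v * a) + a := by rw [h1, hsum]
        _ = _ := by ring
    have h3 : G.avg φ v = φ v + a :=
      (ENNReal.add_left_inj ((hhalf v).trans_lt (by simp)).ne).1 h2
    rw [h3]
    calc φ v + a = φ v + 2 * a * 2⁻¹ := by
          rw [mul_comm 2 a, mul_assoc, ENNReal.mul_inv_cancel (by simp) (by simp), mul_one]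
      _ ≤ φ v + 2 * a * φ v := by gcongr; exact hφ2 v
      _ = (1 + K⁻¹) * φ v := by rw [h2a]; ring
      _ ≤ s * φ v := by gcongr
  have key : ∀ m, ∀ v, G.graph.dist z v ≤ r → G.exitBy B m v ≤ M * s ^ m * φ v := by
    intro m
    induction m with
    | zero =>
      intro v hv
      by_cases hvA : v ∈ A
      · rw [exitBy_zero_of_mem G (hAB hvA)]
        exact zero_le
      · simpa [hφ, τ, meanExit_of_notMem G hvA] using hM v hv 0
    | succ m ih =>
      intro v hv
      by_cases hvA : v ∈ A
      · rw [exitBy_succ_of_mem G (hAB hvA)]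
        calc G.avg (G.exitBy B m) v ≤ G.avg (fun u => M * s ^ m * φ u) v := by
              refine G.avg_le_avg fun u hu => ih u ?_
              have h1 := G.mem_ball_natCast.1 hvA
              have h2 := G.dist_le_one_of_prob_ne_zero hu
              have h3 := G.dist_triangle z v u
              omega
          _ = M * s ^ m * G.avg φ v := G.avg_const_mul _ _ _
          _ ≤ M * s ^ m * (s * φ v) := by gcongr; exact hφA v hvA
          _ = _ := by ring
      · simpa [hφ, τ, meanExit_of_notMem G hvA] using hM v hv (m + 1)
  exact key m z (by simp)

/-- The walk must leave `k` balls of radius `r` in succession, each contributing `q`; the time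
factor `s^m` is paid only once. -/
theorem exitBy_ball_le_pow [Nontrivial Γ] {x : Γ} {R r : ℕ} {s q : ℝ≥0∞} (hs1 : 1 ≤ s)
    (h : ∀ z, G.graph.dist x z + r ≤ R → ∃ K : ℝ≥0∞, K ≠ 0 ∧ K ≠ ∞ ∧
      (∀ v, G.meanExit (G.ball z r) v ≤ K) ∧ 1 + K⁻¹ ≤ s ∧
      1 - G.meanExit (G.ball z r) z * (2 * K)⁻¹ ≤ q) (k : ℕ) :
    ∀ z, G.graph.dist x z + k * r ≤ R → ∀ m, G.exitBy (G.ball x R) m z ≤ q ^ k * s ^ m := by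
  induction k with
  | zero =>
    intro z _ m
    rw [pow_zero, one_mul]
    exact (G.exitBy_le_one _ _ _).trans (one_le_pow₀ hs1)
  | succ k ih =>
    intro z hz m
    rw [add_mul, one_mul] at hz
    obtain ⟨K, hK0, hKt, hK, hKs, hKq⟩ := h z (by omega)
    refine (G.exitBy_le_of_exit_ball (M := q ^ k) hK0 hKt hK hKs ?_ ?_ m).trans ?_
    · intro v hv
      rw [mem_ball_natCast] at hv ⊢
      have := G.dist_triangle x z v
      omega
    · intro u hu
      have := G.dist_triangle x z u
      exact ih u (by omega)
    · calc q ^ k * s ^ m * (1 - G.meanExit (G.ball z r) z * (2 * K)⁻¹)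
          ≤ q ^ k * s ^ m * q := by gcongr
        _ = q ^ (k + 1) * s ^ m := by ring

/-- The mean exit times of two nested sets, compared through the boundary of the smaller one. -/
theorem meanExit_ball_add_le [Nontrivial Γ] {x : Γ} {r : ℕ} {B : Set Γ} {c : ℝ≥0∞}
    (hct : c ≠ ∞) (hfin : G.meanExit (G.ball x r) x ≠ ∞) (hAB : G.ball x r ⊆ B)
    (hc : ∀ u, G.graph.dist x u = r → c ≤ G.meanExit B u) :
    G.meanExit (G.ball x r) x + c ≤ G.meanExit B x := by
  set A := G.ball x r
  -- The version stopped at time `n`: the sum is the mean of `min(T_A, n)`, and `c` is earned only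
  -- if the exit has occurred. Finiteness then makes survival tend to 0.
  have key : ∀ n, ∀ z, G.graph.dist x z ≤ r →
      ∑ k ∈ Finset.range n, (G.kill A)^[k + 1] (fun _ => 1) z + c * G.exitBy A n z ≤
        G.meanExit B z := by
    have hout : ∀ n, ∀ z, G.graph.dist x z ≤ r → z ∉ A →
        ∑ k ∈ Finset.range n, (G.kill A)^[k + 1] (fun _ => 1) z + c * G.exitBy A n z ≤
          G.meanExit B z := by
      intro n z hz hzA
      have hr := hc z (le_antisymm hz (not_lt.1 fun h => hzA (G.mem_ball_natCast.2 h)))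
      simpa [Function.iterate_succ_apply', kill_of_notMem G hzA, exitBy_of_notMem G hzA] using hr
    intro n
    induction n with
    | zero =>
      intro z hz
      by_cases hzA : z ∈ A
      · simp [exitBy_zero_of_mem G hzA]
      · exact hout 0 z hz hzA
    | succ n ih =>
      intro z hz
      by_cases hzA : z ∈ A
      · rw [meanExit_of_mem G (hAB hzA), exitBy_succ_of_mem G hzA, Finset.sum_range_succ']
        have h0 : (G.kill A)^[0 + 1] (fun _ => 1) z = 1 := by
          simp [kill_of_mem G hzA, avg_const]
        have h1 : ∑ k ∈ Finset.range n, (G.kill A)^[k + 1 + 1] (fun _ => 1) z =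
            G.avg (fun v => ∑ k ∈ Finset.range n, (G.kill A)^[k + 1] (fun _ => 1) v) z := by
          simp only [Function.iterate_succ_apply' _ (_ + 1), kill_of_mem G hzA]
          simp only [avg, Finset.mul_sum]
          exact (Summable.tsum_finsetSum fun _ _ => ENNReal.summable).symm
        rw [h0, h1, add_comm _ (1 : ℝ≥0∞), add_assoc, ← avg_const_mul, ← avg_add]
        gcongr
        refine G.avg_le_avg fun v hv => ih v ?_
        have h1 := G.mem_ball_natCast.1 hzA
        have h2 := G.dist_le_one_of_prob_ne_zero hv
        have h3 := G.dist_triangle x z v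
        omega
      · exact hout (n + 1) z hz hzA
  have hu : Tendsto (fun n : ℕ => (G.kill A)^[n + 1] (fun _ => 1) x) atTop (𝓝 0) :=
    ENNReal.tendsto_atTop_zero_of_tsum_ne_top hfin
  have hL : Tendsto (fun n => ∑ k ∈ Finset.range n, (G.kill A)^[k + 1] (fun _ => 1) x + c)
      atTop (𝓝 (G.meanExit A x + c)) :=
    (ENNReal.tendsto_nat_tsum _).add_const c
  have hR : Tendsto (fun n : ℕ => G.meanExit B x + c * (G.kill A)^[n + 1] (fun _ => 1) x)
      atTop (𝓝 (G.meanExit B x + c * 0)) :=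
    tendsto_const_nhds.add (ENNReal.Tendsto.const_mul hu (Or.inr hct))
  rw [mul_zero, add_zero] at hR
  refine le_of_tendsto_of_tendsto' hL hR fun n => ?_
  calc _ = ∑ k ∈ Finset.range n, (G.kill A)^[k + 1] (fun _ => 1) x +
        c * (G.exitBy A n x + (G.kill A)^[n + 1] (fun _ => 1) x) := by
        rw [exitBy_add_survival, mul_one]
    _ = (∑ k ∈ Finset.range n, (G.kill A)^[k + 1] (fun _ => 1) x + c * G.exitBy A n x) +
        c * (G.kill A)^[n + 1] (fun _ => 1) x := by ring
    _ ≤ _ := by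
        gcongr
        exact key n x (by simp)

end WeightedGraph

/-! ### Consequences of the time comparison principle -/

namespace WeightedGraph

open MeasureTheory ProbabilityTheory Filter Topology

variable {Γ : Type*} (G : WeightedGraph Γ)

theorem ball_subset_ball {x y : Γ} {r s : ℕ} (h : G.graph.dist y x + r ≤ s) :
    G.ball x r ⊆ G.ball y s := fun z hz => by
  rw [mem_ball_natCast] at hz ⊢
  have := G.dist_triangle y x z
  omega

set_option linter.unusedSectionVars false

variable [MeasurableSpace Γ] [DiscreteMeasurableSpace Γ] [Countable Γ] [Nontrivial Γ]

/-- Finite mean exit times from balls which satisfy the time comparison principle at integer radii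
and are bounded for balls of radius one. -/
structure TimeRegular (C : ℝ) : Prop where
  four_le : 4 ≤ C
  ne_top : ∀ (x : Γ) (n : ℕ) (z : Γ), G.meanExit (G.ball x n) z ≠ ∞
  compare : ∀ (x y : Γ) (R : ℕ), G.graph.dist x y < R → G.E x (2 * R : ℕ) ≤ C * G.E y R
  E_one_le : ∀ x, G.E x (1 : ℕ) ≤ C

theorem E_nonneg (x : Γ) (R : ℝ) : 0 ≤ G.E x R := ENNReal.toReal_nonneg

theorem E_zero (x : Γ) : G.E x (0 : ℕ) = 0 := by
  rw [E_eq, meanExit_of_notMem]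
  · simp
  · rw [mem_ball_natCast]
    simp

namespace TimeRegular

variable {G} {C : ℝ}

theorem pos (h : G.TimeRegular C) : 0 < C := by linarith [h.four_le]

theorem ofReal_E (h : G.TimeRegular C) (x : Γ) (R : ℕ) :
    ENNReal.ofReal (G.E x R) = G.meanExit (G.ball x R) x := by
  rw [E_eq, ENNReal.ofReal_toReal (h.ne_top x R x)]

theorem E_mono (h : G.TimeRegular C) (x : Γ) {R S : ℕ} (hRS : R ≤ S) : G.E x R ≤ G.E x S := by
  rw [E_eq, E_eq]
  refine ENNReal.toReal_mono (h.ne_top x S x) (G.meanExit_mono (G.ball_subset_ball ?_) x)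
  simpa using hRS

theorem one_le_E (h : G.TimeRegular C) (x : Γ) {R : ℕ} (hR : 1 ≤ R) : 1 ≤ G.E x R := by
  rw [E_eq, ← ENNReal.toReal_one]
  refine ENNReal.toReal_mono (h.ne_top x R x) (G.one_le_meanExit ?_)
  rw [mem_ball_natCast]
  simpa using Nat.lt_of_succ_le hR

theorem E_le_mul (h : G.TimeRegular C) (x y : Γ) {R : ℕ} (hR : G.graph.dist x y < R) :
    G.E x R ≤ C * G.E y R :=
  (h.E_mono x (by omega)).trans (h.compare x y R hR)

theorem E_two_pow_mul_le (h : G.TimeRegular C) (x : Γ) {R : ℕ} (hR : 1 ≤ R) (i : ℕ) :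
    G.E x (2 ^ i * R : ℕ) ≤ C ^ i * G.E x R := by
  induction i with
  | zero => simp
  | succ i ih =>
    have h1 := h.compare x x (2 ^ i * R) (by simpa using by omega)
    rw [← mul_assoc, ← pow_succ'] at h1
    calc _ ≤ C * G.E x (2 ^ i * R : ℕ) := h1
      _ ≤ C * (C ^ i * G.E x R) := by
        gcongr
        exact h.pos.le
      _ = _ := by ring

/-- For `v` in the ball, `B(z,r) ⊆ B(v,2r)`, and (TC) compares `E(v,2r)` with `E(z,r)`. -/
theorem meanExit_ball_le (h : G.TimeRegular C) (z v : Γ) (r : ℕ) :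
    G.meanExit (G.ball z r) v ≤ ENNReal.ofReal (C * G.E z r) := by
  by_cases hv : v ∈ G.ball z r
  · rw [mem_ball_natCast, SimpleGraph.dist_comm] at hv
    refine (G.meanExit_mono (G.ball_subset_ball (y := v) (s := 2 * r) (by omega)) v).trans ?_
    rw [← h.ofReal_E]
    exact ENNReal.ofReal_le_ofReal (h.compare v z r hv)
  · rw [meanExit_of_notMem G hv]
    exact zero_le

theorem E_le_pow_mul (h : G.TimeRegular C) {x z : Γ} {R r i : ℕ} (hr : 1 ≤ r)
    (hz : G.graph.dist x z < R) (hR : R ≤ 2 ^ i * r) : G.E x R ≤ C ^ (i + 1) * G.E z r := by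
  have hC := h.pos
  calc G.E x R ≤ C * G.E z R := h.E_le_mul x z hz
    _ ≤ C * G.E z (2 ^ i * r : ℕ) := by
      gcongr
      exact h.E_mono z hR
    _ ≤ C * (C ^ i * G.E z r) := by
      gcongr
      exact h.E_two_pow_mul_le z hr i
    _ = _ := by ring

theorem one_sub_meanExit_le (h : G.TimeRegular C) (z : Γ) {r : ℕ} (hr : 1 ≤ r) :
    1 - G.meanExit (G.ball z r) z * (2 * ENNReal.ofReal (C * G.E z r))⁻¹ ≤
      ENNReal.ofReal (1 - 1 / (2 * C)) := by
  have hC := h.pos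
  have hC4 := h.four_le
  have hE : 0 < G.E z r := lt_of_lt_of_le one_pos (h.one_le_E z hr)
  have hq0 : 0 ≤ 1 - 1 / (2 * C) := by
    rw [sub_nonneg, div_le_one (by positivity)]
    linarith
  have hk : 0 < 2 * (C * G.E z r) := by positivity
  have h2 : 2 * ENNReal.ofReal (C * G.E z r) = ENNReal.ofReal (2 * (C * G.E z r)) := by
    rw [ENNReal.ofReal_mul zero_le_two, ENNReal.ofReal_ofNat]
  rw [← h.ofReal_E, h2, ← ENNReal.ofReal_inv_of_pos hk, ← ENNReal.ofReal_mul hE.le]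
  refine tsub_le_iff_right.2 ?_
  rw [← ENNReal.ofReal_add hq0 (by positivity), ENNReal.one_le_ofReal]
  refine le_of_eq ?_
  field_simp
  ring

/-- Chaining with `r = ⌊R/2^i⌋` and `K = C E(z,r)`. As `R ≤ 2^{i+1} r`, one has `E(x,R) ≤ C^{i+2}
E(z,r)`, which bounds `1/K` uniformly in `z`. -/
theorem exitBy_ball_le_pow (h : G.TimeRegular C) (x : Γ) {R i : ℕ} (hR : 2 ^ i ≤ R) (n : ℕ) :
    G.exitBy (G.ball x R) n x ≤ ENNReal.ofReal (1 - 1 / (2 * C)) ^ 2 ^ i *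
      ENNReal.ofReal (1 + C ^ (i + 1) / G.E x R) ^ n := by
  have hC := h.pos
  have h2i : 0 < 2 ^ i := Nat.two_pow_pos i
  have hE : 0 < G.E x R := lt_of_lt_of_le one_pos (h.one_le_E x (by omega))
  obtain ⟨r, hr1, hrR, hRr⟩ : ∃ r, 1 ≤ r ∧ 2 ^ i * r ≤ R ∧ R ≤ 2 ^ (i + 1) * r := by
    refine ⟨R / 2 ^ i, (Nat.one_le_div_iff h2i).2 hR, Nat.mul_div_le R (2 ^ i), ?_⟩
    have h1 : R < 2 ^ i * (R / 2 ^ i + 1) := Nat.lt_mul_div_succ R h2i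
    have h2 : 1 ≤ R / 2 ^ i := (Nat.one_le_div_iff h2i).2 hR
    calc R ≤ 2 ^ i * (R / 2 ^ i + 1) := h1.le
      _ ≤ 2 ^ i * (R / 2 ^ i + R / 2 ^ i) := by gcongr
      _ = 2 ^ (i + 1) * (R / 2 ^ i) := by ring
  refine G.exitBy_ball_le_pow (r := r) ?_ (fun z hz => ?_) (2 ^ i) x (by simpa using hrR) n
  · rw [ENNReal.one_le_ofReal, le_add_iff_nonneg_right]
    exact div_nonneg (pow_nonneg hC.le _) hE.le
  have hEz : 0 < G.E z r := lt_of_lt_of_le one_pos (h.one_le_E z hr1)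
  have hk : 0 < C * G.E z r := mul_pos hC hEz
  refine ⟨ENNReal.ofReal (C * G.E z r), (ENNReal.ofReal_pos.2 hk).ne', ENNReal.ofReal_ne_top,
    fun v => h.meanExit_ball_le z v r, ?_, h.one_sub_meanExit_le z hr1⟩
  have hsum : 1 + (ENNReal.ofReal (C * G.E z r))⁻¹ = ENNReal.ofReal (1 + (C * G.E z r)⁻¹) := by
    rw [ENNReal.ofReal_add zero_le_one (inv_nonneg.2 hk.le), ENNReal.ofReal_one,
      ENNReal.ofReal_inv_of_pos hk]
  rw [hsum]
  refine ENNReal.ofReal_le_ofReal (add_le_add_right ?_ 1)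
  rw [inv_eq_one_div, div_le_div_iff₀ hk hE, one_mul]
  calc _ ≤ C ^ (i + 1 + 1) * G.E z r := h.E_le_pow_mul hr1 (by omega) hRr
    _ = _ := by ring

theorem exitBy_ball_le_exp (h : G.TimeRegular C) (x : Γ) {R i : ℕ} (hR : 2 ^ i ≤ R) (n : ℕ) :
    G.exitBy (G.ball x R) n x ≤
      ENNReal.ofReal (Real.exp (n * (C ^ (i + 1) / G.E x R) - 2 ^ i / (2 * C))) := by
  have hC := h.pos
  have hC4 := h.four_le
  have hq0 : 0 ≤ 1 - 1 / (2 * C) := by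
    rw [sub_nonneg, div_le_one (by positivity)]
    linarith
  have hs0 : 0 ≤ C ^ (i + 1) / G.E x R := div_nonneg (pow_nonneg hC.le _) (G.E_nonneg _ _)
  refine (h.exitBy_ball_le_pow x hR n).trans ?_
  rw [← ENNReal.ofReal_pow hq0, ← ENNReal.ofReal_pow (by linarith),
    ← ENNReal.ofReal_mul (pow_nonneg hq0 _)]
  refine ENNReal.ofReal_le_ofReal ?_
  have h1 : (1 - 1 / (2 * C)) ^ 2 ^ i ≤ Real.exp (-(2 ^ i / (2 * C))) := by
    have := Real.add_one_le_exp (-(1 / (2 * C)))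
    calc (1 - 1 / (2 * C)) ^ 2 ^ i ≤ Real.exp (-(1 / (2 * C))) ^ 2 ^ i :=
          pow_le_pow_left₀ hq0 (by linarith) _
      _ = _ := by
        rw [← Real.exp_nat_mul]
        congr 1
        push_cast
        ring
  have h2 : (1 + C ^ (i + 1) / G.E x R) ^ n ≤ Real.exp (n * (C ^ (i + 1) / G.E x R)) := by
    have := Real.add_one_le_exp (C ^ (i + 1) / G.E x R)
    rw [Real.exp_nat_mul]
    exact pow_le_pow_left₀ (by linarith) (by linarith) _
  refine (mul_le_mul h1 h2 (pow_nonneg (by linarith) _) (Real.exp_nonneg _)).trans_eq ?_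
  rw [← Real.exp_add]
  congr 1
  ring

/-- The tail estimate for exit times. -/
theorem exitBy_ball_le (h : G.TimeRegular C) (x : Γ) {R n : ℕ} (hR : 1 ≤ R) (hn : R ≤ n) :
    G.exitBy (G.ball x R) n x ≤ ENNReal.ofReal (Real.exp
      (1 - (8 * C * (4 * C ^ 2) ^ (1 / (Real.logb 2 C - 1)))⁻¹ *
        (G.E x R / n) ^ (1 / (Real.logb 2 C - 1)))) := by
  have hC := h.pos
  have hC4 := h.four_le
  set δ : ℝ := 1 / (Real.logb 2 C - 1) with hδ
  set Z : ℝ := G.E x R / n with hZ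
  have hE1 : 1 ≤ G.E x R := h.one_le_E x hR
  have hn0 : (0 : ℝ) < n := by exact_mod_cast (by omega : 0 < n)
  have hZ0 : 0 < Z := by positivity
  have hlog : Real.logb 2 C - 1 = Real.logb 2 (C / 2) := by
    rw [Real.logb_div hC.ne' (by norm_num), Real.logb_self_eq_one (by norm_num)]
  have hlogpos : 0 < Real.logb 2 (C / 2) := Real.logb_pos (by norm_num) (by linarith)
  have hδ0 : 0 < δ := by
    rw [hδ, hlog]
    positivity
  -- This fixes the exponent: it turns the scale `(C/2)^i` of `Z` into the number `2^i` of
  -- crossings.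
  have hCδ : (C / 2) ^ δ = 2 := by
    have h1 : (2 : ℝ) ^ Real.logb 2 (C / 2) = C / 2 :=
      Real.rpow_logb (by norm_num) (by norm_num) (by positivity)
    conv_lhs => rw [← h1]
    rw [← Real.rpow_mul (by norm_num), hδ, hlog, mul_one_div_cancel hlogpos.ne', Real.rpow_one]
  have hsplit : (8 * C * (4 * C ^ 2) ^ δ)⁻¹ * Z ^ δ = (Z / (4 * C ^ 2)) ^ δ / (8 * C) := by
    rw [Real.div_rpow hZ0.le (by positivity)]
    field_simp
  rw [hsplit]
  rcases lt_or_ge Z (4 * C ^ 2) with hlt | hge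
  · refine (G.exitBy_le_one _ _ _).trans ?_
    rw [ENNReal.one_le_ofReal, Real.one_le_exp_iff, sub_nonneg, div_le_one (by positivity)]
    have : (Z / (4 * C ^ 2)) ^ δ ≤ 1 := by
      refine Real.rpow_le_one (by positivity) ?_ hδ0.le
      rw [div_le_one (by positivity)]
      exact hlt.le
    linarith
  -- The choice `(C/2)^i ≤ Z/(4C²)` makes the time cost `C^{i+1}/Z` at most half of the gain
  -- `2^i/(2C)`; the upper bound on `Z` makes `2^i` comparable with `Z^δ`.
  · obtain ⟨i, hi1, hi2⟩ := exists_nat_pow_near (x := Z / (4 * C ^ 2)) (y := C / 2)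
      ((one_le_div (by positivity)).2 hge) (by linarith)
    obtain ⟨m, hm1, hm2⟩ := exists_nat_pow_near hR (by norm_num : 1 < 2)
    have hm1' : (2 : ℝ) ^ m ≤ n := by exact_mod_cast hm1.trans hn
    have hER : G.E x R ≤ C ^ (m + 2) := by
      calc G.E x R ≤ G.E x (2 ^ (m + 1) * 1 : ℕ) := h.E_mono x (by omega)
        _ ≤ C ^ (m + 1) * G.E x (1 : ℕ) := h.E_two_pow_mul_le x le_rfl _
        _ ≤ C ^ (m + 1) * C := by
          gcongr
          exact h.E_one_le x
        _ = _ := by ring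
    have hZm : Z ≤ C ^ 2 * (C / 2) ^ m := by
      calc Z ≤ C ^ (m + 2) / 2 ^ m := by
            rw [hZ]
            gcongr
        _ = _ := by
          rw [div_pow]
          ring
    -- The small balls need `2^i ≤ R`. This is where `R ≤ n` enters: with `E(x,R) ≤ C^{m+2}` it
    -- limits `Z`.
    have him : i ≤ m := by
      refine (pow_le_pow_iff_right₀ (by linarith : 1 < C / 2)).1 (hi1.trans ?_)
      rw [div_le_iff₀ (by positivity)]
      have : 0 ≤ C ^ 2 * (C / 2) ^ m := by positivity
      linarith
    refine (h.exitBy_ball_le_exp x ((Nat.pow_le_pow_right (by norm_num) him).trans hm1) n).trans ?_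
    refine ENNReal.ofReal_le_ofReal (Real.exp_le_exp.2 ?_)
    have h1 : n * (C ^ (i + 1) / G.E x R) ≤ 2 ^ i / (4 * C) := by
      have : n * (C ^ (i + 1) / G.E x R) = C ^ (i + 1) / Z := by
        rw [hZ]
        field_simp
      rw [this, div_le_iff₀ hZ0]
      rw [le_div_iff₀ (by positivity), div_pow, div_mul_eq_mul_div,
        div_le_iff₀ (by positivity)] at hi1
      calc C ^ (i + 1) = (C ^ i * (4 * C ^ 2)) / (4 * C) := by field_simp; ring
        _ ≤ (Z * 2 ^ i) / (4 * C) := by gcongr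
        _ = _ := by ring
    have h2 : (Z / (4 * C ^ 2)) ^ δ ≤ 2 ^ (i + 1) := by
      calc (Z / (4 * C ^ 2)) ^ δ ≤ ((C / 2) ^ (i + 1)) ^ δ :=
            Real.rpow_le_rpow (by positivity) hi2.le hδ0.le
        _ = ((C / 2) ^ δ) ^ (i + 1) := by
          rw [← Real.rpow_natCast, ← Real.rpow_natCast, ← Real.rpow_mul (by positivity),
            ← Real.rpow_mul (by positivity), mul_comm]
        _ = _ := by rw [hCδ]
    have h3 : (Z / (4 * C ^ 2)) ^ δ / (8 * C) ≤ 2 ^ i / (4 * C) := by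
      calc _ ≤ 2 ^ (i + 1) / (8 * C) := by gcongr
        _ = _ := by
          rw [pow_succ]
          field_simp
          norm_num
    have h4 : (2 : ℝ) ^ i / (2 * C) = 2 ^ i / (4 * C) + 2 ^ i / (4 * C) := by
      field_simp
      norm_num
    linarith

/-- On leaving `B(x,R)` at `u`, the walk must still leave `B(u,R) ⊆ B(x,2R)`, which takes mean time
at least `C⁻² E(x,R)`. -/
theorem E_two_mul_ge (h : G.TimeRegular C) (x : Γ) {R : ℕ} (hR : 1 ≤ R) :
    (1 + (C ^ 2)⁻¹) * G.E x R ≤ G.E x (2 * R : ℕ) := by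
  have hC := h.pos
  have key := G.meanExit_ball_add_le (x := x) (r := R) (B := G.ball x (2 * R : ℕ))
    (c := ENNReal.ofReal ((C ^ 2)⁻¹ * G.E x R)) ENNReal.ofReal_ne_top (h.ne_top x R x)
    (G.ball_subset_ball (by simp; omega)) ?_
  · rw [← h.ofReal_E, ← h.ofReal_E, ← ENNReal.ofReal_add (G.E_nonneg _ _)
      (mul_nonneg (by positivity) (G.E_nonneg _ _)),
      ENNReal.ofReal_le_ofReal_iff (G.E_nonneg _ _)] at key
    linarith
  · intro u hu
    refine le_trans ?_ (G.meanExit_mono (G.ball_subset_ball (x := u) (r := R) (by omega)) u)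
    rw [← h.ofReal_E]
    refine ENNReal.ofReal_le_ofReal ?_
    rw [inv_mul_le_iff₀ (by positivity)]
    calc G.E x R ≤ G.E x (2 * R : ℕ) := h.E_mono x (by omega)
      _ ≤ C * G.E u (2 * R : ℕ) := h.E_le_mul x u (by omega)
      _ ≤ C * (C * G.E u R) := by
        gcongr
        exact h.compare u u R (by simpa using by omega)
      _ = _ := by ring

theorem exists_two_mul_E_le (h : G.TimeRegular C) :
    ∃ a : ℕ, ∀ (x : Γ) (R : ℕ), 1 ≤ R → 2 * G.E x R ≤ G.E x (2 ^ a * R : ℕ) := by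
  have hC := h.pos
  obtain ⟨a, ha⟩ := pow_unbounded_of_one_lt 2
    (show 1 < 1 + (C ^ 2)⁻¹ by linarith [show 0 < (C ^ 2)⁻¹ by positivity])
  refine ⟨a, fun x R hR => ?_⟩
  have key : ∀ i : ℕ, (1 + (C ^ 2)⁻¹) ^ i * G.E x R ≤ G.E x (2 ^ i * R : ℕ) := by
    intro i
    induction i with
    | zero => simp
    | succ i ih =>
      have h1 := h.E_two_mul_ge x (R := 2 ^ i * R) (Nat.mul_pos (by positivity) hR)
      rw [← mul_assoc, ← pow_succ'] at h1
      refine le_trans ?_ h1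
      rw [pow_succ', mul_assoc]
      gcongr
  refine le_trans ?_ (key a)
  gcongr
  exact G.E_nonneg _ _

end TimeRegular

end WeightedGraph

/-! ### Volumes at the natural scale and diagonal bounds -/

namespace WeightedGraph

open MeasureTheory ProbabilityTheory Filter Topology

variable {Γ : Type*} (G : WeightedGraph Γ)

section Volume

variable {G}

theorem tsum_mass_ne_top (hfin : ∀ (x : Γ) (n : ℕ), (G.ball x n).Finite) (x : Γ) (n : ℕ) :
    ∑' y : G.ball x n, (G.mass y : ℝ≥0∞) ≠ ∞ := by
  have := (hfin x n).fintype
  rw [tsum_fintype]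
  exact ENNReal.sum_ne_top.2 fun _ _ => ENNReal.coe_ne_top

theorem V_le_V (hfin : ∀ (x : Γ) (n : ℕ), (G.ball x n).Finite) {x y : Γ} {r s : ℕ}
    (h : G.graph.dist y x + r ≤ s) : G.V x r ≤ G.V y s :=
  ENNReal.toReal_mono (tsum_mass_ne_top hfin y s)
    (ENNReal.tsum_mono_subtype (fun y => (G.mass y : ℝ≥0∞)) (G.ball_subset_ball h))

theorem V_one (x : Γ) : G.V x (1 : ℕ) = G.mass x := by
  have h : G.ball x (1 : ℕ) = {x} := by
    ext y
    rw [mem_ball_natCast, Nat.lt_one_iff]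
    exact (G.connected.dist_eq_zero_iff).trans eq_comm
  rw [V, h, tsum_singleton x (fun y => (G.mass y : ℝ≥0∞)), ENNReal.coe_toReal]

theorem V_pos [Nontrivial Γ] (hfin : ∀ (x : Γ) (n : ℕ), (G.ball x n).Finite) (x : Γ) {r : ℕ}
    (hr : 1 ≤ r) : 0 < G.V x r :=
  calc (0 : ℝ) < G.mass x := G.mass_pos x
    _ = G.V x (1 : ℕ) := (V_one x).symm
    _ ≤ G.V x r := V_le_V hfin (by simpa using hr)

theorem V_two_pow_mul_le {D : ℝ} (hD : 1 ≤ D)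
    (hVD : ∀ (x : Γ) (R : ℝ), 0 < R → G.V x (2 * R) ≤ D * G.V x R) (x : Γ) {r : ℕ} (hr : 1 ≤ r)
    (i : ℕ) : G.V x (2 ^ i * r : ℕ) ≤ D ^ i * G.V x r := by
  induction i with
  | zero => simp
  | succ i ih =>
    have h1 := hVD x (2 ^ i * r : ℕ) (by exact_mod_cast Nat.mul_pos (Nat.two_pow_pos i) hr)
    have h2 : (2 : ℝ) * (2 ^ i * r : ℕ) = (2 ^ (i + 1) * r : ℕ) := by
      push_cast
      ring
    rw [h2] at h1
    calc _ ≤ _ := h1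
      _ ≤ D * (D ^ i * G.V x r) := by gcongr
      _ = _ := by ring

end Volume

set_option linter.unusedSectionVars false

variable [MeasurableSpace Γ] [DiscreteMeasurableSpace Γ] [Countable Γ] [Nontrivial Γ]

namespace TimeRegular

variable {G} {C : ℝ}

theorem two_pow_mul_E_le {a : ℕ}
    (ha : ∀ (x : Γ) (R : ℕ), 1 ≤ R → 2 * G.E x R ≤ G.E x (2 ^ a * R : ℕ)) (x : Γ) {R : ℕ}
    (hR : 1 ≤ R) (i : ℕ) : 2 ^ i * G.E x R ≤ G.E x ((2 ^ a) ^ i * R : ℕ) := by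
  induction i with
  | zero => simp
  | succ i ih =>
    have h1 := ha x ((2 ^ a) ^ i * R) (Nat.mul_pos (by positivity) hR)
    rw [← mul_assoc, ← pow_succ'] at h1
    refine le_trans ?_ h1
    rw [pow_succ', mul_assoc]
    gcongr

/-- Geometric growth of `E` makes the set defining `e` nonempty, so its `sInf` is attained and is
not the default 0. -/
theorem le_E_e (h : G.TimeRegular C) (x : Γ) (n : ℕ) : (n : ℝ) ≤ G.E x (G.e x n) := by
  obtain ⟨a, ha⟩ := h.exists_two_mul_E_le
  refine Nat.sInf_mem (s := {R : ℕ | (n : ℝ) ≤ G.E x R}) ⟨(2 ^ a) ^ n * 1, ?_⟩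
  change (n : ℝ) ≤ G.E x ((2 ^ a) ^ n * 1 : ℕ)
  refine le_trans ?_ (two_pow_mul_E_le ha x le_rfl n)
  have h1 : (n : ℝ) ≤ 2 ^ n := by exact_mod_cast Nat.lt_two_pow_self.le
  have h2 := h.one_le_E x le_rfl
  nlinarith [show (0 : ℝ) < 2 ^ n by positivity]

theorem one_le_e (h : G.TimeRegular C) (x : Γ) {n : ℕ} (hn : 0 < n) : 1 ≤ G.e x n := by
  rw [Nat.one_le_iff_ne_zero]
  intro h0
  have h1 := h.le_E_e x n
  rw [h0, E_zero] at h1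
  have : (0 : ℝ) < n := by exact_mod_cast hn
  linarith

theorem e_one (h : G.TimeRegular C) (x : Γ) : G.e x 1 = 1 :=
  le_antisymm (Nat.sInf_le (by simpa using h.one_le_E x le_rfl)) (h.one_le_e x one_pos)

theorem E_e_le (h : G.TimeRegular C) (x : Γ) {n : ℕ} (hn : 0 < n) :
    G.E x (G.e x n) ≤ C * n := by
  have hC := h.pos
  have h1 := h.one_le_e x hn
  have hn1 : (1 : ℝ) ≤ n := by exact_mod_cast hn
  rcases h1.eq_or_lt with h2 | h2
  · rw [← h2]
    exact (h.E_one_le x).trans (le_mul_of_one_le_right hC.le hn1)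
  · have h3 : G.E x (G.e x n - 1 : ℕ) < n := by
      refine not_le.1 fun hle => ?_
      have : G.e x n ≤ G.e x n - 1 := Nat.sInf_le hle
      omega
    calc G.E x (G.e x n) ≤ G.E x (2 * (G.e x n - 1) : ℕ) := h.E_mono x (by omega)
      _ ≤ C * G.E x (G.e x n - 1 : ℕ) := h.compare x x _ (by simpa using h2)
      _ ≤ C * n := by gcongr

/-- Comparison of the volumes at the natural scales of two points. -/
theorem V_e_le (h : G.TimeRegular C) (hfin : ∀ (x : Γ) (n : ℕ), (G.ball x n).Finite) {D : ℝ}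
    (hD : 1 ≤ D) (hVD : ∀ (x : Γ) (R : ℝ), 0 < R → G.V x (2 * R) ≤ D * G.V x R) {a α : ℕ}
    (ha : ∀ (x : Γ) (R : ℕ), 1 ≤ R → 2 * G.E x R ≤ G.E x (2 ^ a * R : ℕ)) (hα : D ^ a ≤ 2 ^ α)
    {x u : Γ} {d n m : ℕ} (hd : G.graph.dist x u ≤ d) (hn : 0 < n) (hm : 0 < m)
    (hnm : n ≤ 8 * m) :
    G.V x (G.e x n) ≤ D * (16 * C ^ 3 * (1 + G.E x d / n)) ^ α * G.V u (G.e u m) := by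
  have hC := h.pos
  have hC4 := h.four_le
  set ρ := G.e x n with hρ
  set σ := G.e u m with hσ
  have hρ1 : 1 ≤ ρ := h.one_le_e x hn
  have hσ1 : 1 ≤ σ := h.one_le_e u hm
  have hn0 : (0 : ℝ) < n := by exact_mod_cast hn
  have hm0 : (0 : ℝ) < m := by exact_mod_cast hm
  have hZ : 0 ≤ G.E x d / n := div_nonneg (G.E_nonneg _ _) hn0.le
  set Z := G.E x d / n with hZdef
  have hV : 0 < G.V u σ := V_pos hfin u hσ1
  -- Each factor `2^a` in the radius doubles `E(u,·)`. It starts from at least `m ≥ n/8` at `σ` and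
  -- is at most `C³ n (1 + Z)` at `max ρ d`, so the least such `i` satisfies `2^i ≲ 1 + Z`.
  have key : ∃ i : ℕ, max ρ d ≤ (2 ^ a) ^ i * σ ∧ (2 : ℝ) ^ i ≤ 16 * C ^ 3 * (1 + Z) := by
    have hE : G.E u (max ρ d : ℕ) ≤ C ^ 3 * n * (1 + Z) := by
      have h1 : G.E x (max ρ d : ℕ) ≤ C * n * (1 + Z) := by
        have hdn : G.E x d = n * Z := by
          rw [hZdef]
          field_simp
        rcases le_total ρ d with hle | hle
        · rw [max_eq_right hle, hdn]
          nlinarith [mul_nonneg hn0.le hZ, mul_pos hC hn0]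
        · rw [max_eq_left hle]
          have := h.E_e_le x hn
          nlinarith [mul_nonneg (mul_pos hC hn0).le hZ]
      have hdist : G.graph.dist u x < 2 * max ρ d := by
        rw [SimpleGraph.dist_comm]
        have := le_max_left ρ d
        have := le_max_right ρ d
        omega
      calc G.E u (max ρ d : ℕ) ≤ G.E u (2 * max ρ d : ℕ) := h.E_mono u (by omega)
        _ ≤ C * G.E x (2 * max ρ d : ℕ) := h.E_le_mul u x hdist
        _ ≤ C * (C * G.E x (max ρ d : ℕ)) := by
          gcongr
          exact h.compare x x _ (by simp; omega)
        _ ≤ C * (C * (C * n * (1 + Z))) := by gcongr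
        _ = _ := by ring
    have hstep : ∀ i : ℕ, (2 ^ a) ^ i * σ ≤ max ρ d → (2 : ℝ) ^ (i + 1) ≤ 16 * C ^ 3 * (1 + Z) := by
      intro i hi
      have h1 : (2 : ℝ) ^ i * m ≤ C ^ 3 * n * (1 + Z) := by
        calc (2 : ℝ) ^ i * m ≤ 2 ^ i * G.E u σ := by
              gcongr
              exact h.le_E_e u m
          _ ≤ G.E u ((2 ^ a) ^ i * σ : ℕ) := two_pow_mul_E_le ha u hσ1 i
          _ ≤ G.E u (max ρ d : ℕ) := h.E_mono u hi
          _ ≤ _ := hE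
      have h2 : (n : ℝ) ≤ 8 * m := by exact_mod_cast hnm
      have h3 : (2 : ℝ) ^ i * m ≤ 8 * C ^ 3 * (1 + Z) * m := by
        calc _ ≤ _ := h1
          _ ≤ C ^ 3 * (8 * m) * (1 + Z) := by gcongr
          _ = _ := by ring
      have h4 := le_of_mul_le_mul_right h3 hm0
      rw [pow_succ]
      linarith
    classical
    have hex : ∃ i : ℕ, max ρ d ≤ (2 ^ a) ^ i * σ := by
      by_contra! hcon
      obtain ⟨i, hi⟩ := pow_unbounded_of_one_lt (16 * C ^ 3 * (1 + Z)) (one_lt_two (α := ℝ))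
      have h1 := hstep i (hcon i).le
      have h2 : (2 : ℝ) ^ i ≤ 2 ^ (i + 1) := pow_le_pow_right₀ one_le_two (Nat.le_succ i)
      linarith
    refine ⟨Nat.find hex, Nat.find_spec hex, ?_⟩
    rcases Nat.eq_zero_or_pos (Nat.find hex) with h0 | hpos
    · rw [h0, pow_zero]
      have : 1 ≤ C ^ 3 := one_le_pow₀ (by linarith)
      nlinarith
    · have h1 := Nat.find_min hex (Nat.sub_lt hpos one_pos)
      have h2 := hstep _ (not_le.1 h1).le
      rwa [show Nat.find hex - 1 + 1 = Nat.find hex by omega] at h2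
  obtain ⟨i, hi1, hi2⟩ := key
  have hsub : G.graph.dist u x + ρ ≤ 2 ^ (1 + a * i) * σ := by
    rw [SimpleGraph.dist_comm, pow_add, pow_mul, pow_one, mul_assoc]
    have := le_max_left ρ d
    have := le_max_right ρ d
    omega
  calc G.V x ρ ≤ G.V u (2 ^ (1 + a * i) * σ : ℕ) := V_le_V hfin hsub
    _ ≤ D ^ (1 + a * i) * G.V u σ := V_two_pow_mul_le hD hVD u hσ1 _
    _ = D * (D ^ a) ^ i * G.V u σ := by rw [pow_add, pow_mul, pow_one]
    _ ≤ D * (2 ^ α) ^ i * G.V u σ := by gcongr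
    _ = D * (2 ^ i) ^ α * G.V u σ := by rw [← pow_mul, ← pow_mul, mul_comm α i]
    _ ≤ _ := by gcongr

end TimeRegular

/-- Time 0, which halving small times produces, is covered because `p_0(u,u) = 1/μ(u) =
1/V(u,e(u,1))`. -/
theorem heat_self_le_of_diagonal {C K : ℝ} (h : G.TimeRegular C) (hK : 1 ≤ K)
    (hDUE : ∀ (x : Γ) (n : ℕ), 0 < n → G.p n x x ≤ K / G.V x (G.e x n)) (u : Γ) (m : ℕ) :
    G.heat m u u ≤ ENNReal.ofReal (K / G.V u (G.e u (max m 1))) := by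
  rw [← ENNReal.ofReal_toReal (G.heat_ne_top m u u), ← p_eq]
  refine ENNReal.ofReal_le_ofReal ?_
  rcases Nat.eq_zero_or_pos m with rfl | hm
  · rw [max_eq_right (Nat.zero_le 1), h.e_one, V_one, p, P_eq, stepProb_zero_self]
    simp only [ENNReal.toReal_one]
    gcongr
  · rw [max_eq_left hm]
    exact hDUE u m hm

/-- Compare with the term `t^k/k!` of the exponential series, for `k ≥ α/δ`. -/
theorem one_add_pow_le_exp (α : ℕ) {δ c : ℝ} (hδ : 0 < δ) (hc : 0 < c) :
    ∃ K : ℝ, 1 ≤ K ∧ ∀ Z : ℝ, 0 ≤ Z → (1 + Z) ^ α ≤ K * Real.exp (c * Z ^ δ) := by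
  obtain ⟨k, hk⟩ := exists_nat_ge (α / δ)
  refine ⟨2 ^ α * (1 + k.factorial / c ^ k), ?_, fun Z hZ => ?_⟩
  · have h1 : (1 : ℝ) ≤ 2 ^ α := one_le_pow₀ one_le_two
    have h2 : 0 ≤ k.factorial / c ^ k := by positivity
    nlinarith
  have hZδ : 0 ≤ Z ^ δ := Real.rpow_nonneg hZ δ
  have hexp : 1 ≤ Real.exp (c * Z ^ δ) := Real.one_le_exp (by positivity)
  have hfac : 0 ≤ k.factorial / c ^ k := by positivity
  rcases le_total Z 1 with h1 | h1
  · calc (1 + Z) ^ α ≤ 2 ^ α * 1 * 1 := by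
          rw [mul_one, mul_one]
          gcongr
          linarith
      _ ≤ _ := by
        gcongr
        linarith
  · have hpow : Z ^ α ≤ (Z ^ δ) ^ k := by
      rw [← Real.rpow_natCast, ← Real.rpow_natCast, ← Real.rpow_mul hZ]
      refine Real.rpow_le_rpow_of_exponent_le h1 ?_
      rwa [div_le_iff₀ hδ, mul_comm] at hk
    have hb := Real.pow_div_factorial_le_exp (c * Z ^ δ) (by positivity) k
    rw [div_le_iff₀ (by positivity), mul_pow] at hb
    calc (1 + Z) ^ α ≤ (2 * Z) ^ α := by
          gcongr
          linarith
      _ = 2 ^ α * Z ^ α := mul_pow _ _ _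
      _ ≤ 2 ^ α * ((k.factorial / c ^ k) * Real.exp (c * Z ^ δ)) := by
        gcongr
        refine hpow.trans ?_
        rw [div_mul_eq_mul_div, le_div_iff₀ (by positivity)]
        linarith
      _ ≤ _ := by
        rw [← mul_assoc]
        gcongr
        linarith

/-- The off-diagonal bound in terms of the exit times of balls around the two points. -/
theorem heat_le_of_diagonal {x y : Γ} {n : ℕ} {S : ℝ≥0∞}
    (hS : ∀ u, G.graph.dist x u ≤ 2 * G.graph.dist x y → ∀ m, n ≤ 8 * max m 1 →
      G.heat m u u ≤ S) {r : ℕ} (hr : 2 * r ≤ G.graph.dist x y) (hn2 : 2 ≤ n) :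
    G.heat n x y ≤ 2 * S *
      (G.exitBy (G.ball x r) n x + G.exitBy (G.ball y r) n y) := by
  -- Times `t ≥ ⌊n/2⌋` are halved again; the factor 8 leaves room for both roundings.
  have hoff : ∀ u v, G.graph.dist x u ≤ 2 * G.graph.dist x y →
      G.graph.dist x v ≤ 2 * G.graph.dist x y → ∀ t, n / 2 ≤ t → G.heat t u v ≤ 2 * S := by
    intro u v hu hv t ht
    have h1 := G.heat_add_le (t / 2) (t - t / 2) u v
    rw [show t / 2 + (t - t / 2) = t by omega] at h1
    refine h1.trans ?_
    rw [two_mul]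
    exact add_le_add (hS u hu _ (by omega)) (hS v hv _ (by omega))
  have hmono : ∀ A : Set Γ, ∀ z, Monotone fun k => G.exitBy A k z := fun A z =>
    monotone_nat_of_le_succ fun k => G.exitBy_le_succ A k z
  have key := G.heat_le_exitBy (x := x) (y := y) (r := r) (k := n / 2) (l := n - n / 2)
    (S := 2 * S) hr ?_ ?_
  · rw [show n / 2 + (n - n / 2) = n by omega] at key
    refine key.trans ?_
    gcongr
    · exact hmono _ _ (by omega)
    · exact hmono _ _ (by omega)
  · exact fun u hu j _ => hoff u y (by omega) (by omega) _ (by omega)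
  · intro u hu j _
    have := G.dist_triangle x y u
    exact hoff u x (by omega) (by simp) _ (by omega)

end WeightedGraph

/-! ### Assembly of the upper estimate -/

namespace WeightedGraph

open MeasureTheory ProbabilityTheory Filter Topology

variable {Γ : Type*} {G : WeightedGraph Γ}

theorem ControlledWeights.exists_nnreal (hp : G.ControlledWeights) :
    ∃ q : ℝ≥0, 0 < q ∧ ∀ x y, 0 < G.weight x y → q ≤ G.prob x y := by
  obtain ⟨p₀, hp₀, h⟩ := hp
  refine ⟨p₀.toNNReal, Real.toNNReal_pos.2 hp₀, fun x y hxy => ?_⟩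
  rw [Real.toNNReal_le_iff_le_coe, prob, NNReal.coe_div]
  exact h x y hxy

/-- The ratio in (TC) would be 0 for a vanishing denominator, so positivity and finiteness of the
mean exit times must come first. -/
theorem exists_timeRegular [Infinite Γ] [MeasurableSpace Γ] [DiscreteMeasurableSpace Γ]
    [Countable Γ] {q : ℝ≥0} (hq : 0 < q) (hG : ∀ x y, 0 < G.weight x y → q ≤ G.prob x y)
    (hTC : G.TimeComparison) : ∃ C, G.TimeRegular C := by
  obtain ⟨CT, -, hTC⟩ := hTC
  refine ⟨max (max 4 CT) (q : ℝ)⁻¹, ?_, meanExit_ball_ne_top hq hG, ?_, ?_⟩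
  · exact (le_max_left _ _).trans (le_max_left _ _)
  · intro x y R hxy
    have hR : (0 : ℝ) < R := by exact_mod_cast (Nat.zero_le _).trans_lt hxy
    have hE : 0 < G.E y R := by
      rw [E_eq]
      refine ENNReal.toReal_pos (lt_of_lt_of_le one_pos (G.one_le_meanExit ?_)).ne'
        (meanExit_ball_ne_top hq hG y R y)
      rw [mem_ball_natCast]
      simpa using (Nat.zero_le _).trans_lt hxy
    have h1 := hTC x R hR y (G.mem_ball_natCast.2 hxy)
    rw [div_le_iff₀ hE] at h1
    push_cast
    refine h1.trans ?_
    gcongr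
    exact (le_max_right _ _).trans (le_max_left _ _)
  · intro x
    refine le_trans ?_ (le_max_right _ _)
    rw [E_eq]
    have h1 := ENNReal.toReal_mono (by simpa using hq.ne') (meanExit_ball_one_le hq hG x)
    simpa using h1

variable [MeasurableSpace Γ] [DiscreteMeasurableSpace Γ] [Countable Γ] [Nontrivial Γ]

/-- The heat kernel bound, with a constant `S` which bounds the diagonal near the two points. -/
theorem TimeRegular.heat_le {C : ℝ} (h : G.TimeRegular C) {x y : Γ} {n : ℕ} (hn : 0 < n) {S : ℝ≥0∞}
    (hS : ∀ u, G.graph.dist x u ≤ 2 * G.graph.dist x y → ∀ m, n ≤ 8 * max m 1 →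
      G.heat m u u ≤ S) {δ c : ℝ} (hδ : δ = 1 / (Real.logb 2 C - 1))
    (hc : c = (8 * C * (4 * C ^ 2) ^ δ)⁻¹ / (C ^ 3) ^ δ) :
    G.heat n x y ≤
      4 * S * ENNReal.ofReal (Real.exp (1 - c * (G.E x (G.graph.dist x y) / n) ^ δ)) := by
  have hC := h.pos
  have hC4 := h.four_le
  have hn0 : (0 : ℝ) < n := by exact_mod_cast hn
  have hβ : 1 < Real.logb 2 C := by
    rw [Real.lt_logb_iff_rpow_lt (by norm_num) hC]
    norm_num
    linarith
  have hδ0 : 0 < δ := by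
    rw [hδ]
    exact one_div_pos.2 (by linarith)
  set d := G.graph.dist x y with hd
  set Z := G.E x d / n with hZ
  have hZ0 : 0 ≤ Z := div_nonneg (G.E_nonneg _ _) hn0.le
  -- For `Z ≤ C` the exponential factor is at least 1 and the diagonal bound suffices. Otherwise `d
  -- ≥ 2`, so the radius `d/2` is at least 1; if `n < d` the kernel vanishes, so the tail estimate
  -- may assume `d ≤ n`.
  rcases le_or_gt Z C with hZC | hZC
  · have hsmall : c * Z ^ δ ≤ 1 := by
      have h1 : Z ^ δ ≤ (4 * C ^ 2) ^ δ := by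
        refine Real.rpow_le_rpow hZ0 ?_ hδ0.le
        nlinarith
      have h2 : 1 ≤ (C ^ 3) ^ δ :=
        Real.one_le_rpow (one_le_pow₀ (by linarith)) hδ0.le
      have h3 : c ≤ (8 * C * (4 * C ^ 2) ^ δ)⁻¹ := by
        rw [hc]
        exact div_le_self (by positivity) h2
      calc c * Z ^ δ ≤ (8 * C * (4 * C ^ 2) ^ δ)⁻¹ * (4 * C ^ 2) ^ δ := by gcongr
        _ = (8 * C)⁻¹ := by field_simp
        _ ≤ 1 := inv_le_one_of_one_le₀ (by linarith)
    have h1 := G.heat_add_le (n / 2) (n - n / 2) x y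
    rw [show n / 2 + (n - n / 2) = n by omega] at h1
    calc G.heat n x y ≤ S + S :=
          h1.trans (add_le_add (hS x (by simp) _ (by omega)) (hS y (by omega) _ (by omega)))
      _ = 2 * S * 1 := by ring
      _ ≤ _ := by
        gcongr
        · norm_num
        · rw [ENNReal.one_le_ofReal]
          exact Real.one_le_exp (by linarith)
  · have hd2 : 2 ≤ d := by
      by_contra! hlt
      have h1 : G.E x d ≤ C := (h.E_mono x (by omega)).trans (h.E_one_le x)
      have h2 : Z ≤ C := by
        rw [hZ, div_le_iff₀ hn0]
        have : (1 : ℝ) ≤ n := by exact_mod_cast hn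
        nlinarith
      linarith
    rcases lt_or_ge n d with hnd | hnd
    · rw [heat, G.stepProb_eq_zero_of_lt_dist hnd]
      simp
    have htail : ∀ z, G.graph.dist x z ≤ d → G.exitBy (G.ball z (d / 2 : ℕ)) n z ≤
        ENNReal.ofReal (Real.exp (1 - c * Z ^ δ)) := by
      intro z hz
      refine (h.exitBy_ball_le z (by omega) (by omega)).trans ?_
      rw [← hδ]
      refine ENNReal.ofReal_le_ofReal (Real.exp_le_exp.2 (sub_le_sub_left ?_ 1))
      -- Passing to radius `d + 1` admits `z = y`, and `d + 1 ≤ 4⌊d/2⌋` costs `C³`: the source of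
      -- `(C³)^δ` in `c`.
      have h1 : G.E x d ≤ C ^ 3 * G.E z (d / 2 : ℕ) :=
        (h.E_mono x (Nat.le_succ d)).trans
          (h.E_le_pow_mul (i := 2) (by omega) (by omega) (by omega))
      have h2 : c * Z ^ δ = (8 * C * (4 * C ^ 2) ^ δ)⁻¹ * (Z / C ^ 3) ^ δ := by
        rw [hc, Real.div_rpow hZ0 (by positivity)]
        ring
      rw [h2]
      have h3 : Z / C ^ 3 ≤ G.E z (d / 2 : ℕ) / n := by
        rw [hZ, div_div, mul_comm, ← div_div]
        gcongr
        rwa [div_le_iff₀ (by positivity), mul_comm]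
      gcongr
    calc G.heat n x y ≤ 2 * S * (G.exitBy (G.ball x (d / 2 : ℕ)) n x +
            G.exitBy (G.ball y (d / 2 : ℕ)) n y) :=
          G.heat_le_of_diagonal hS (by omega) (by omega)
      _ ≤ 2 * S * (ENNReal.ofReal (Real.exp (1 - c * Z ^ δ)) +
            ENNReal.ofReal (Real.exp (1 - c * Z ^ δ))) := by
          gcongr
          · exact htail x (by simp)
          · exact htail y le_rfl
      _ = _ := by ring

theorem TimeRegular.heat_self_le {C : ℝ} (h : G.TimeRegular C)
    (hfin : ∀ (x : Γ) (n : ℕ), (G.ball x n).Finite) {D K : ℝ} (hD : 1 ≤ D) (hK : 1 ≤ K)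
    (hVD : ∀ (x : Γ) (R : ℝ), 0 < R → G.V x (2 * R) ≤ D * G.V x R)
    (hDUE : ∀ (x : Γ) (n : ℕ), 0 < n → G.p n x x ≤ K / G.V x (G.e x n)) {a α : ℕ}
    (ha : ∀ (x : Γ) (R : ℕ), 1 ≤ R → 2 * G.E x R ≤ G.E x (2 ^ a * R : ℕ)) (hα : D ^ a ≤ 2 ^ α)
    {x u : Γ} {d n m : ℕ} (hd : G.graph.dist x u ≤ 2 * d) (hn : 0 < n) (hnm : n ≤ 8 * max m 1) :
    G.heat m u u ≤ ENNReal.ofReal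
      (K * D * (16 * C ^ 4) ^ α * (1 + G.E x d / n) ^ α / G.V x (G.e x n)) := by
  have hC := h.pos
  have hC4 := h.four_le
  have hn0 : (0 : ℝ) < n := by exact_mod_cast hn
  refine (G.heat_self_le_of_diagonal h hK hDUE u m).trans (ENNReal.ofReal_le_ofReal ?_)
  have hV := h.V_e_le hfin hD hVD ha hα hd hn (by omega : 0 < max m 1) hnm
  have hVx : 0 < G.V x (G.e x n) := V_pos hfin x (h.one_le_e x hn)
  have hVu : 0 < G.V u (G.e u (max m 1)) := V_pos hfin u (h.one_le_e u (by omega))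
  have hE : G.E x (2 * d : ℕ) ≤ C * G.E x d := by
    rcases Nat.eq_zero_or_pos d with rfl | hd0
    · rw [Nat.mul_zero, E_zero, mul_zero]
    · exact h.compare x x d (by simpa using hd0)
  have hZ0 : 0 ≤ G.E x d / n := div_nonneg (G.E_nonneg _ _) hn0.le
  have hZ : 1 + G.E x (2 * d : ℕ) / n ≤ C * (1 + G.E x d / n) := by
    have : G.E x (2 * d : ℕ) / n ≤ C * (G.E x d / n) := by
      rw [← mul_div_assoc]
      gcongr
    linarith
  have hZ2 : 0 ≤ G.E x (2 * d : ℕ) / n := div_nonneg (G.E_nonneg _ _) hn0.le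
  rw [div_le_div_iff₀ hVu hVx]
  calc K * G.V x (G.e x n)
      ≤ K * (D * (16 * C ^ 3 * (1 + G.E x (2 * d : ℕ) / n)) ^ α * G.V u (G.e u (max m 1))) := by
        gcongr
    _ ≤ K * (D * (16 * C ^ 3 * (C * (1 + G.E x d / n))) ^ α * G.V u (G.e u (max m 1))) := by
        gcongr
    _ = _ := by
      rw [show 16 * C ^ 3 * (C * (1 + G.E x d / n)) = 16 * C ^ 4 * (1 + G.E x d / n) by ring,
        mul_pow]
      ring

end WeightedGraph

theorem mainTheorem7 {Γ : Type*} [Countable Γ] [Infinite Γ]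
    [MeasurableSpace Γ] [DiscreteMeasurableSpace Γ] (G : WeightedGraph Γ)
    (hp : G.ControlledWeights) (hVD : G.VolumeDoubling) (hTC : G.TimeComparison)
    (hDUE : G.DiagonalUpperEstimate) : G.UpperEstimate := by
  obtain ⟨q, hq, hG⟩ := hp.exists_nnreal
  obtain ⟨C, h⟩ := WeightedGraph.exists_timeRegular hq hG hTC
  have hfin := WeightedGraph.finite_ball hq hG
  obtain ⟨D₀, -, hVD₀⟩ := hVD
  obtain ⟨K₀, -, hDUE₀⟩ := hDUE
  obtain ⟨D, hD, hVD⟩ : ∃ D : ℝ, 1 ≤ D ∧ ∀ (x : Γ) (R : ℝ), 0 < R →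
      G.V x (2 * R) ≤ D * G.V x R := by
    refine ⟨max D₀ 1, le_max_right _ _, fun x R hR => (hVD₀ x R hR).trans ?_⟩
    exact mul_le_mul_of_nonneg_right (le_max_left _ _) ENNReal.toReal_nonneg
  obtain ⟨K, hK, hDUE⟩ : ∃ K : ℝ, 1 ≤ K ∧ ∀ (x : Γ) (n : ℕ), 0 < n →
      G.p n x x ≤ K / G.V x (G.e x n) := by
    refine ⟨max K₀ 1, le_max_right _ _, fun x n hn => (hDUE₀ x n hn).trans ?_⟩
    exact div_le_div_of_nonneg_right (le_max_left _ _) ENNReal.toReal_nonneg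
  obtain ⟨a, ha⟩ := h.exists_two_mul_E_le
  obtain ⟨α, hα⟩ := pow_unbounded_of_one_lt (D ^ a) (one_lt_two (α := ℝ))
  have hC := h.pos
  have hC4 := h.four_le
  have hβ : 1 < Real.logb 2 C := by
    rw [Real.lt_logb_iff_rpow_lt (by norm_num) hC]
    norm_num
    linarith
  obtain ⟨δ, hδ⟩ : ∃ δ, δ = 1 / (Real.logb 2 C - 1) := ⟨_, rfl⟩
  obtain ⟨c, hc⟩ : ∃ c, c = (8 * C * (4 * C ^ 2) ^ δ)⁻¹ / (C ^ 3) ^ δ := ⟨_, rfl⟩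
  have hδ0 : 0 < δ := by
    rw [hδ]
    exact one_div_pos.2 (by linarith)
  have hc0 : 0 < c := by
    rw [hc]
    positivity
  -- Half of `c` is spent on absorbing `(1 + Z)^α`; the other half survives in the final exponent.
  obtain ⟨L, hL, hLexp⟩ := WeightedGraph.one_add_pow_le_exp α hδ0 (half_pos hc0)
  obtain ⟨M, hM⟩ : ∃ M, M = K * D * (16 * C ^ 4) ^ α := ⟨_, rfl⟩
  have hM1 : 1 ≤ M := by
    rw [hM]
    have h1 : 1 ≤ (16 * C ^ 4) ^ α :=
      one_le_pow₀ (by nlinarith [one_le_pow₀ (n := 4) (by linarith : (1 : ℝ) ≤ C)])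
    exact one_le_mul_of_one_le_of_one_le (one_le_mul_of_one_le_of_one_le hK hD) h1
  refine ⟨4 * M * L * Real.exp 1, Real.logb 2 C, c / 2, ?_, hβ, half_pos hc0, ?_⟩
  · have h1 : 1 ≤ M * L := one_le_mul_of_one_le_of_one_le hM1 hL
    have h2 : 1 ≤ Real.exp 1 := Real.one_le_exp zero_le_one
    nlinarith
  intro x y n hn
  rw [← hδ]
  have hn0 : (0 : ℝ) < n := by exact_mod_cast hn
  obtain ⟨Z, hZ⟩ : ∃ Z, Z = G.E x (G.graph.dist x y) / n := ⟨_, rfl⟩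
  have hZ0 : 0 ≤ Z := by
    rw [hZ]
    exact div_nonneg (G.E_nonneg _ _) hn0.le
  obtain ⟨v, hv⟩ : ∃ v, v = G.V x (G.e x n) := ⟨_, rfl⟩
  have hv0 : 0 < v := by
    rw [hv]
    exact WeightedGraph.V_pos hfin x (h.one_le_e x hn)
  have hheat := h.heat_le (x := x) (y := y) hn (fun u hu m hm =>
    h.heat_self_le hfin hD hK hVD hDUE ha hα.le hu hn hm) hδ hc
  rw [← hM, ← hZ, ← hv] at hheat
  rw [← hZ, ← hv, WeightedGraph.p_eq]
  have hS0 : 0 ≤ M * (1 + Z) ^ α / v := by positivity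
  have h4 : (4 : ℝ≥0∞) = ENNReal.ofReal 4 := (ENNReal.ofReal_ofNat 4).symm
  rw [h4, ← ENNReal.ofReal_mul (by norm_num), ← ENNReal.ofReal_mul (by positivity)] at hheat
  refine (ENNReal.toReal_le_of_le_ofReal (by positivity) hheat).trans ?_
  calc 4 * (M * (1 + Z) ^ α / v) * Real.exp (1 - c * Z ^ δ)
      ≤ 4 * (M * (L * Real.exp (c / 2 * Z ^ δ)) / v) * Real.exp (1 - c * Z ^ δ) := by
        gcongr
        exact hLexp Z hZ0
    _ = 4 * M * L / v * (Real.exp (c / 2 * Z ^ δ) * Real.exp (1 - c * Z ^ δ)) := by ring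
    _ = 4 * M * L / v * (Real.exp 1 * Real.exp (-(c / 2) * Z ^ δ)) := by
        rw [← Real.exp_add, ← Real.exp_add]
        congr 2
        ring
    _ = _ := by ring
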